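/- All circles lie on the Riemann sphere $\hat{\mathbb C}=\mathbb C\cup\{\infty\}$; straight lines together with $\infty$ are circles. An oriented circle has augmented curvature-center coordinates $(\bar b,b,x,y)$ with $x^2+y^2-b\bar b=1$: if $b\ne 0$, then $b$ is its signed curvature and $(x,y)$ is $b$ times its center, and its interior is the bounded side if $b>0$ and the side containing $\infty$ if $b<0$; if $b=0$, it is the line $\{z: (x,y)\cdot z=\bar b/2\}\cup\{\infty\}$ with interior the half plane $(x,y)\cdot z>\bar b/2$. A (positively oriented) Descartes configuration $\mathcal D$ is a quadruple of mutually tangent oriented circles with pairwise disjoint interiors; $W_{\mathcal D}$ denotes the $4\times4$ matrix whose rows are their coordinates. For $1\le i\le 4$ let $S_i$ be the $4\times 4$ matrix that agrees with the identity except that its $i$-th row has $-1$ on the diagonal and $2$ elsewhere, and let $S_i^\perp=S_i^T$. Let $\mathcal A=\langle S_1,\dots,S_4\rangle$ and $\mathcal A^S=\langle S_1,\dots,S_4,S_1^\perp,\dots,S_4^\perp\rangle$. The Apollonian packing (respectively the geometric Apollonian super-packing) generated by $\mathcal D$ is the set of all (unoriented) circles given by the rows of the matrices $UW_{\mathcal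 D}$ with $U\in\mathcal A$ (respectively $U\in\mathcal A^S$). Fix a generating Descartes configuration $\mathcal D$. The interior, with respect to $\mathcal D$, of a circle $C$ of its super-packing is the side of $C$ that meets none of the four circles of $\mathcal D$. The nesting depth of $C$ with respect to $\mathcal D$ is the number of circles $C'\neq C$ of the super-packing such that $C$ is contained in the union of $C'$ and the interior of $C'$ (so $C$ may touch $C'$). **Theorem.** Let $k\ge 1$. The circles of the super-packing that have nesting depth exactly $k$ with respect to $\mathcal D$ have pairwise disjoint interiors. Moreover, there are an infinite set $\mathcal F$ of Apollonian packings and, for each $P\in\mathcal F$, a circle $B_P\in P$ such that: 1. $B_P$ is a circle of the super-packing of nesting depth exactly $k-1$, and it bounds $P$: every circle of $P$ is contained in the union of $B_P$ and its interior; 2. the sets $P\setminus\{B_P\}$, $P\in\mathcal F$, are pairwise disjoint, and their union is the set of all circles of the super-packing of nesting depth exactly $k$. -/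

import Mathlib

namespace SuperPacking

/-- The Riemann sphere `ℂ ∪ {∞}`. -/
abbrev Sphere : Type := OnePoint ℂ

/-- An oriented circle on the Riemann sphere is given by its augmented curvature-center coordinates
`v = (b', b, x, y)` with `x² + y² - b b' = 1`. If `b ≠ 0`, then `b` is the signed curvature,
`(x, y)` is curvature times center, and `b'` is the curvature of the image under inversion in the
unit circle. If `b = 0`, the circle is the line `{z : (x, y) · z = b' / 2} ∪ {∞}`
with unit normal `(x, y)`. -/
def IsCircleVector (v : Fin 4 → ℝ) : Prop :=
  v 2 ^ 2 + v 3 ^ 2 - v 1 * v 0 = 1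

/-- The function on the sphere that vanishes on the circle with coordinates `v`, is negative on
its interior and positive on its exterior. For `v 1 ≠ 0` and center `c`, its value at a finite
point `z` is `b |z - c|² - 1 / b`. -/
def circleFun (v : Fin 4 → ℝ) : Sphere → ℝ
  | none => v 1
  | some z => v 1 * (z.re ^ 2 + z.im ^ 2) - 2 * (v 2 * z.re + v 3 * z.im) + v 0

/-- The underlying point set of the oriented circle with coordinates `v`. -/
def circle (v : Fin 4 → ℝ) : Set Sphere := {p | circleFun v p = 0}

/-- The interior of the oriented circle with coordinates `v`: the open disc of radius `1 / b` if
the curvature `b` is positive, the complement in the sphere of the closed disc of radius `1 / |b|`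
if `b` is negative, and the open half plane into which the normal points if `b = 0`. -/
def disc (v : Fin 4 → ℝ) : Set Sphere := {p | circleFun v p < 0}

/-- Two circles, as point sets, are tangent if they have exactly one common point. -/
def Tangent (C C' : Set Sphere) : Prop := ∃! p, p ∈ C ∧ p ∈ C'

/-- `W` is the matrix of augmented curvature-center coordinates of an ordered, positively oriented
Descartes configuration: its rows are four mutually tangent circles with disjoint interiors. -/
structure IsDescartes (W : Matrix (Fin 4) (Fin 4) ℝ) : Prop where
  isCircleVector : ∀ i, IsCircleVector (W i)
  tangent : ∀ i j, i ≠ j → Tangent (circle (W i)) (circle (W j))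
  disjoint_interiors : ∀ i j, i ≠ j → Disjoint (disc (W i)) (disc (W j))

/-- The matrix `S_i`: the identity matrix, except that row `i` has `-1` on the diagonal and `2`
off the diagonal. It replaces the `i`-th circle of a Descartes configuration by the other circle
tangent to the remaining three. -/
def swapMatrix (i : Fin 4) : Matrix (Fin 4) (Fin 4) ℤ :=
  Matrix.of fun r c => if r = i then (if c = i then -1 else 2) else (if r = c then 1 else 0)

theorem swapMatrix_mul_self (i : Fin 4) : swapMatrix i * swapMatrix i = 1 := by
  revert i; decide

/-- The generator `S_i` of the Apollonian group. -/
def swap (i : Fin 4) : GL (Fin 4) ℤ :=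
  ⟨swapMatrix i, swapMatrix i, swapMatrix_mul_self i, swapMatrix_mul_self i⟩

/-- The generator `S_i^⊥ = S_iᵀ` of the dual Apollonian group. It reverses the orientation of the
`i`-th circle of a Descartes configuration and reflects the other three in it. -/
def reflect (i : Fin 4) : GL (Fin 4) ℤ :=
  ⟨(swapMatrix i).transpose, (swapMatrix i).transpose,
    by rw [← Matrix.transpose_mul, swapMatrix_mul_self, Matrix.transpose_one],
    by rw [← Matrix.transpose_mul, swapMatrix_mul_self, Matrix.transpose_one]⟩

/-- The Apollonian group `⟨S_1, …, S_4⟩`. -/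
def apollonianGroup : Subgroup (GL (Fin 4) ℤ) :=
  Subgroup.closure (Set.range swap)

/-- The super-Apollonian group `⟨S_1, …, S_4, S_1^⊥, …, S_4^⊥⟩`. -/
def superApollonianGroup : Subgroup (GL (Fin 4) ℤ) :=
  Subgroup.closure (Set.range swap ∪ Set.range reflect)

/-- The action `W ↦ U W` of integer matrices on (coordinate matrices of) Descartes
configurations. -/
def act (U : GL (Fin 4) ℤ) (W : Matrix (Fin 4) (Fin 4) ℝ) : Matrix (Fin 4) (Fin 4) ℝ :=
  (U : Matrix (Fin 4) (Fin 4) ℤ).map (Int.cast : ℤ → ℝ) * W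

/-- The set of all circles occurring in the configurations of the orbit of `W` under `G`. -/
def orbitCircles (G : Subgroup (GL (Fin 4) ℤ)) (W : Matrix (Fin 4) (Fin 4) ℝ) :
    Set (Set Sphere) :=
  {C | ∃ U ∈ G, ∃ i, C = circle (act U W i)}

/-- The set of circles of the geometric Apollonian super-packing generated by `W`. -/
def superPacking (W : Matrix (Fin 4) (Fin 4) ℝ) : Set (Set Sphere) :=
  orbitCircles superApollonianGroup W

/-- `P` is the set of circles of the Apollonian packing generated by some Descartes
configuration. -/
def IsApollonianPacking (P : Set (Set Sphere)) : Prop :=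
  ∃ D : Matrix (Fin 4) (Fin 4) ℝ, IsDescartes D ∧ P = orbitCircles apollonianGroup D

/-- `U` is one of the two sides of the circle `C`, that is, the interior of `C` for one of its two
orientations. -/
def IsSide (C U : Set Sphere) : Prop :=
  ∃ v : Fin 4 → ℝ, IsCircleVector v ∧ C = circle v ∧ U = disc v

/-- The interior of the circle `C` with respect to the Descartes configuration `W`: the side of
`C` that meets none of the four circles of `W`. -/
def interiorOf (W : Matrix (Fin 4) (Fin 4) ℝ) (C : Set Sphere) : Set Sphere :=
  ⋃₀ {U | IsSide C U ∧ ∀ j, Disjoint U (circle (W j))}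

/-- The circle `C` includes the circle `C'` in its interior: `C'` lies in the closed disc
consisting of `C` and its interior with respect to `W` (internal tangency is allowed). -/
def Includes (W : Matrix (Fin 4) (Fin 4) ℝ) (C C' : Set Sphere) : Prop :=
  C' ⊆ C ∪ interiorOf W C

/-- The nesting depth of `C` with respect to `W`: the number of other circles of the super-packing
generated by `W` that include `C` in their interior. -/
noncomputable def nestingDepth (W : Matrix (Fin 4) (Fin 4) ℝ) (C : Set Sphere) : ℕ∞ :=
  Set.encard {C' | C' ∈ superPacking W ∧ C' ≠ C ∧ Includes W C' C}

/-- The circles of the super-packing generated by `W` that have nesting depth exactly `k`. -/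
def circlesAtDepth (W : Matrix (Fin 4) (Fin 4) ℝ) (k : ℕ) : Set (Set Sphere) :=
  {C | C ∈ superPacking W ∧ nestingDepth W C = k}

end SuperPacking

namespace SuperPacking

open Matrix

/-! Integer coordinates with respect to the rows of `W` turn the theorem into arithmetic of the form
`gram`, of signature (3,1). Descent on `height` (`exists_single_vecMul_eq_neg`) shows that the
circles of the super-packing correspond to the integer vectors of norm one, up to sign; positive
height selects the orientation whose disc avoids `W`. Inclusion of circles becomes the order "`b -
a` lies in the future cone" (`includes_iff`).

Two norm-one vectors have odd Gram product, so it is never strictly between -1 and 1: two circles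
are nested or have disjoint interiors (`isFuture_trichotomy`). The circles around a given circle
therefore form a chain, and depth is position in a forest.

The top level of the forest is the Apollonian packing of `W` itself (`isOutermost_iff`), because
descent from an outermost root needs only the swaps. For any root `a` there is a group element `U`
taking some `e_i` to `-a`; it carries the outermost roots other than `e_i` onto the children of `a`
(`IsOutermost.isChild`, `IsChild.exists_isOutermost`). So `a` and its children form one Apollonian
packing, and level `k` is the disjoint union of the sets of children of the roots at level `k - 1`.

The geometric input is that the values at a point of the four functions `circleFun (W j)` form a
vector of the same 45° cone (`circleFun_quadratic`, `circleFun_sum_pos`); self-duality of the cone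
makes the function of a future vector nonnegative. -/

/-- The sum of the coordinates of an integer vector. -/
def height (a : Fin 4 → ℤ) : ℤ := ∑ i, a i

/-- The Gram form of a Descartes configuration: `Q(e_i, e_i) = 1` and `Q(e_i, e_j) = -1`. -/
def gram (a b : Fin 4 → ℤ) : ℤ := 2 * ∑ i, a i * b i - height a * height b

/-- The integer vectors of norm one and positive height: the coordinates of the circles of the
super-packing, oriented such that the interior avoids the generating configuration. -/
def roots : Set (Fin 4 → ℤ) := {a | gram a a = 1 ∧ 0 < height a}

/-- The integer vectors in the closed future cone of the Gram form. -/
def IsFuture (c : Fin 4 → ℤ) : Prop := gram c c ≤ 0 ∧ 0 ≤ height c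

/-! ### The Gram form and the order given by the future cone -/

theorem height_add (a b : Fin 4 → ℤ) : height (a + b) = height a + height b := by
  simp [height, Finset.sum_add_distrib]

theorem height_sub (a b : Fin 4 → ℤ) : height (a - b) = height a - height b := by
  simp [height, Finset.sum_sub_distrib]

theorem height_neg (a : Fin 4 → ℤ) : height (-a) = -height a := by
  simp [height]

theorem height_single (i : Fin 4) : height (Pi.single i 1) = 1 := by
  simp [height]

theorem gram_comm (a b : Fin 4 → ℤ) : gram a b = gram b a := by
  simp only [gram, mul_comm]

theorem gram_add_self (a b : Fin 4 → ℤ) :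
    gram (a + b) (a + b) = gram a a + 2 * gram a b + gram b b := by
  simp only [gram, height, Fin.sum_univ_four, Pi.add_apply]; ring

theorem gram_sub_self (a b : Fin 4 → ℤ) :
    gram (a - b) (a - b) = gram a a - 2 * gram a b + gram b b := by
  simp only [gram, height, Fin.sum_univ_four, Pi.sub_apply]; ring

theorem gram_neg_left (a b : Fin 4 → ℤ) : gram (-a) b = -gram a b := by
  simp only [gram, height, Fin.sum_univ_four, Pi.neg_apply]; ring

theorem gram_neg_right (a b : Fin 4 → ℤ) : gram a (-b) = -gram a b := by
  rw [gram_comm, gram_neg_left, gram_comm]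

theorem gram_neg_neg (a b : Fin 4 → ℤ) : gram (-a) (-b) = gram a b := by
  rw [gram_neg_left, gram_neg_right, neg_neg]

theorem gram_single_right (a : Fin 4 → ℤ) (i : Fin 4) :
    gram a (Pi.single i 1) = 2 * a i - height a := by
  simp [gram, height_single, Pi.single_apply]

theorem gram_single_single {i j : Fin 4} (h : i ≠ j) :
    gram (Pi.single i 1) (Pi.single j 1) = -1 := by
  rw [gram_single_right, height_single, Pi.single_apply, if_neg h.symm]; rfl

theorem single_mem_roots (i : Fin 4) : Pi.single i 1 ∈ roots := by
  refine ⟨?_, by simp [height_single]⟩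
  rw [gram_single_right, height_single, Pi.single_eq_same]; rfl

/-- The cone of opening angle `45°` around `(1, 1, 1, 1)` is self-dual. -/
theorem abs_four_mul_sum_sub_le {c d : Fin 4 → ℝ} (hc : 2 * ∑ i, c i ^ 2 ≤ (∑ i, c i) ^ 2)
    (hd : 2 * ∑ i, d i ^ 2 ≤ (∑ i, d i) ^ 2) (hc0 : 0 ≤ ∑ i, c i) (hd0 : 0 ≤ ∑ i, d i) :
    |4 * ∑ i, c i * d i - (∑ i, c i) * ∑ i, d i| ≤ (∑ i, c i) * ∑ i, d i := by
  -- Cauchy-Schwarz for the components orthogonal to `(1, 1, 1, 1)`, scaled by 4. The upper bound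
  -- obtained yields `IsFuture.gram_nonpos`, the lower one `circleFun_nonneg`.
  have key := Finset.sum_mul_sq_le_sq_mul_sq Finset.univ
    (fun i => 4 * c i - ∑ j, c j) (fun i => 4 * d i - ∑ j, d j)
  refine abs_le_of_sq_le_sq ?_ (mul_nonneg hc0 hd0)
  have e1 : ∑ i, (4 * c i - ∑ j, c j) * (4 * d i - ∑ j, d j)
      = 4 * (4 * ∑ i, c i * d i - (∑ i, c i) * ∑ i, d i) := by
    simp only [Fin.sum_univ_four]; ring
  have e2 (c : Fin 4 → ℝ) : ∑ i, (4 * c i - ∑ j, c j) ^ 2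
      = 4 * (4 * ∑ i, c i ^ 2 - (∑ i, c i) ^ 2) := by
    simp only [Fin.sum_univ_four]; ring
  rw [e1, e2, e2] at key
  have hc' : 0 ≤ 4 * ∑ i, c i ^ 2 - (∑ i, c i) ^ 2 := by
    have := e2 c
    have : 0 ≤ ∑ i, (4 * c i - ∑ j, c j) ^ 2 := Finset.sum_nonneg fun i _ => sq_nonneg _
    linarith
  have : (4 * ∑ i, c i ^ 2 - (∑ i, c i) ^ 2) * (4 * ∑ i, d i ^ 2 - (∑ i, d i) ^ 2)
      ≤ (∑ i, c i) ^ 2 * (∑ i, d i) ^ 2 :=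
    mul_le_mul (by linarith) (by linarith) (by
      have := e2 d
      have : 0 ≤ ∑ i, (4 * d i - ∑ j, d j) ^ 2 := Finset.sum_nonneg fun i _ => sq_nonneg _
      linarith) (sq_nonneg _)
  nlinarith

theorem IsFuture.cast {c : Fin 4 → ℤ} (h : IsFuture c) :
    2 * ∑ i, (c i : ℝ) ^ 2 ≤ (∑ i, (c i : ℝ)) ^ 2 ∧ 0 ≤ ∑ i, (c i : ℝ) := by
  obtain ⟨h1, h2⟩ := h
  constructor
  · have : 2 * ∑ i, c i ^ 2 ≤ (∑ i, c i) ^ 2 := by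
      simp only [gram, height, Fin.sum_univ_four] at h1 ⊢; linarith
    exact_mod_cast this
  · simp only [height] at h2
    exact_mod_cast h2

theorem isFuture_zero : IsFuture 0 := by
  simp [IsFuture, gram, height]

theorem IsFuture.gram_nonpos {c d : Fin 4 → ℤ} (hc : IsFuture c) (hd : IsFuture d) :
    gram c d ≤ 0 := by
  have h := (abs_le.1 (abs_four_mul_sum_sub_le hc.cast.1 hd.cast.1 hc.cast.2 hd.cast.2)).2
  have : 4 * ∑ i, c i * d i - (∑ i, c i) * ∑ i, d i ≤ (∑ i, c i) * ∑ i, d i := by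
    exact_mod_cast h
  simp only [gram, height]
  linarith

theorem IsFuture.add {c d : Fin 4 → ℤ} (hc : IsFuture c) (hd : IsFuture d) : IsFuture (c + d) := by
  refine ⟨?_, ?_⟩
  · rw [gram_add_self]
    linarith [hc.1, hd.1, hc.gram_nonpos hd]
  · rw [height_add]
    exact add_nonneg hc.2 hd.2

theorem IsFuture.sub_trans {a b c : Fin 4 → ℤ} (h : IsFuture (a - b)) (h' : IsFuture (b - c)) :
    IsFuture (a - c) := by
  simpa using h.add h'

/-- On the hyperplane of height zero the form is twice the Euclidean one, hence definite. -/
theorem eq_zero_of_gram_nonpos {c : Fin 4 → ℤ} (h : gram c c ≤ 0) (h0 : height c = 0) : c = 0 := by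
  rw [gram, h0] at h
  have h' : ∑ i, c i * c i ≤ 0 := by linarith
  ext i
  exact mul_self_eq_zero.1 ((Finset.sum_eq_zero_iff_of_nonneg fun i _ => mul_self_nonneg (c i)).1
    (h'.antisymm (Finset.sum_nonneg fun i _ => mul_self_nonneg (c i))) i (Finset.mem_univ i))

theorem IsFuture.height_pos {c : Fin 4 → ℤ} (h : IsFuture c) (h0 : c ≠ 0) : 0 < height c :=
  lt_of_le_of_ne h.2 fun e => h0 (eq_zero_of_gram_nonpos h.1 e.symm)

theorem IsFuture.height_lt {a b : Fin 4 → ℤ} (h : IsFuture (b - a)) (hne : a ≠ b) :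
    height a < height b := by
  have := h.height_pos (sub_ne_zero.2 hne.symm)
  rw [height_sub] at this
  linarith

theorem IsFuture.antisymm {a b : Fin 4 → ℤ} (h : IsFuture (b - a)) (h' : IsFuture (a - b)) :
    a = b := by
  by_contra hne
  exact lt_asymm (h.height_lt hne) (h'.height_lt (Ne.symm hne))

theorem odd_height {a : Fin 4 → ℤ} (h : gram a a = 1) : Odd (height a) := by
  by_contra hn
  rw [Int.not_odd_iff_even] at hn
  obtain ⟨k, hk⟩ := hn
  rw [gram, hk] at h
  have : (2 : ℤ) * (∑ i, a i * a i - (k + k) * k) = 1 := by linarith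
  omega

/-- Modulo 2 the product is `height a * height b`, which is odd; only the value 0 has to be
excluded. Geometrically, no two circles cross. -/
theorem gram_le_neg_one_or {a b : Fin 4 → ℤ} (ha : gram a a = 1) (hb : gram b b = 1) :
    gram a b ≤ -1 ∨ 1 ≤ gram a b := by
  obtain ⟨k, hk⟩ := (odd_height ha).mul (odd_height hb)
  rw [gram, hk]
  omega

theorem mem_roots_or_neg_mem {a : Fin 4 → ℤ} (h : gram a a = 1) : a ∈ roots ∨ -a ∈ roots := by
  obtain ⟨k, hk⟩ := odd_height h
  rcases lt_or_ge 0 (height a) with h0 | h0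
  · exact .inl ⟨h, h0⟩
  · refine .inr ⟨by rwa [gram_neg_neg], ?_⟩
    rw [height_neg]
    omega

theorem isFuture_add_of_gram {a b : Fin 4 → ℤ} (ha : a ∈ roots) (hb : b ∈ roots)
    (h : gram a b ≤ -1) : IsFuture (a + b) := by
  refine ⟨?_, ?_⟩
  · rw [gram_add_self, ha.1, hb.1]; linarith
  · rw [height_add]; linarith [ha.2, hb.2]

theorem isFuture_sub_of_gram {a b : Fin 4 → ℤ} (ha : a ∈ roots) (hb : b ∈ roots)
    (h : 1 ≤ gram a b) (hle : height a ≤ height b) : IsFuture (b - a) := by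
  refine ⟨?_, ?_⟩
  · rw [gram_sub_self, ha.1, hb.1, gram_comm]; linarith
  · rw [height_sub]; linarith

theorem IsFuture.one_le_gram {a b : Fin 4 → ℤ} (ha : a ∈ roots) (hb : b ∈ roots)
    (h : IsFuture (b - a)) : 1 ≤ gram a b := by
  have := h.1
  rw [gram_sub_self, ha.1, hb.1, gram_comm] at this
  linarith

theorem isFuture_trichotomy {a b : Fin 4 → ℤ} (ha : a ∈ roots) (hb : b ∈ roots) :
    IsFuture (b - a) ∨ IsFuture (a - b) ∨ IsFuture (a + b) := by
  rcases gram_le_neg_one_or ha.1 hb.1 with h | h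
  · exact .inr (.inr (isFuture_add_of_gram ha hb h))
  · rcases le_total (height a) (height b) with h' | h'
    · exact .inl (isFuture_sub_of_gram ha hb h h')
    · exact .inr (.inl (isFuture_sub_of_gram hb ha (by rwa [gram_comm]) h'))

/-- Otherwise `(c - a) + (c - b) + (a + b) = 2c` would be future, but it has norm 4. -/
theorem isFuture_sub_or_sub {a b c : Fin 4 → ℤ} (ha : a ∈ roots) (hb : b ∈ roots) (hc : c ∈ roots)
    (hca : IsFuture (c - a)) (hcb : IsFuture (c - b)) : IsFuture (b - a) ∨ IsFuture (a - b) := by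
  rcases isFuture_trichotomy ha hb with h | h | h
  · exact .inl h
  · exact .inr h
  · have h2 : IsFuture (c + c) := by
      convert (hca.add hcb).add h using 1
      abel
    have := h2.1
    rw [gram_add_self, hc.1] at this
    norm_num at this

/-! ### The action of the generators -/

theorem vecMul_swapMatrix (a : Fin 4 → ℤ) (l j : Fin 4) :
    (a ᵥ* swapMatrix l) j = if j = l then -a l else a j + 2 * a l := by
  simp only [Matrix.vecMul, dotProduct, swapMatrix, Matrix.of_apply, Fin.sum_univ_four]
  fin_cases l <;> fin_cases j <;> simp <;> ring

theorem vecMul_swapMatrix_transpose (a : Fin 4 → ℤ) (l j : Fin 4) :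
    (a ᵥ* (swapMatrix l)ᵀ) j = if j = l then 2 * height a - 3 * a l else a j := by
  simp only [Matrix.vecMul, dotProduct, swapMatrix, Matrix.of_apply, Fin.sum_univ_four, height,
    Matrix.transpose_apply]
  fin_cases l <;> fin_cases j <;> simp <;> ring

theorem height_vecMul_swapMatrix (a : Fin 4 → ℤ) (l : Fin 4) :
    height (a ᵥ* swapMatrix l) = height a + 4 * a l := by
  simp only [height, vecMul_swapMatrix, Fin.sum_univ_four]
  fin_cases l <;> simp <;> ring

theorem height_vecMul_swapMatrix_transpose (a : Fin 4 → ℤ) (l : Fin 4) :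
    height (a ᵥ* (swapMatrix l)ᵀ) = 3 * height a - 4 * a l := by
  simp only [height, vecMul_swapMatrix_transpose, Fin.sum_univ_four]
  fin_cases l <;> simp <;> ring

theorem gram_vecMul_swapMatrix (a b : Fin 4 → ℤ) (l : Fin 4) :
    gram (a ᵥ* swapMatrix l) (b ᵥ* swapMatrix l) = gram a b := by
  simp only [gram, height_vecMul_swapMatrix]
  simp only [height, vecMul_swapMatrix, Fin.sum_univ_four]
  fin_cases l <;> simp <;> ring

theorem gram_vecMul_swapMatrix_transpose (a b : Fin 4 → ℤ) (l : Fin 4) :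
    gram (a ᵥ* (swapMatrix l)ᵀ) (b ᵥ* (swapMatrix l)ᵀ) = gram a b := by
  simp only [gram, height_vecMul_swapMatrix_transpose]
  simp only [height, vecMul_swapMatrix_transpose, Fin.sum_univ_four]
  fin_cases l <;> simp <;> ring

/-- The Cauchy-Schwarz inequality for the three coordinates different from `l`. -/
theorem eight_mul_sq_le (c : Fin 4 → ℤ) (l : Fin 4) :
    8 * c l ^ 2 - 4 * height c * c l - height c ^ 2 ≤ 3 * gram c c := by
  simp only [gram, height, Fin.sum_univ_four]
  fin_cases l <;> simp <;>
    nlinarith [sq_nonneg (c 0 - c 1), sq_nonneg (c 0 - c 2), sq_nonneg (c 0 - c 3),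
      sq_nonneg (c 1 - c 2), sq_nonneg (c 1 - c 3), sq_nonneg (c 2 - c 3)]

/-- An integer matrix, acting on row vectors, that preserves the Gram form and the time
orientation. -/
structure IsOrthochronous (U : GL (Fin 4) ℤ) : Prop where
  gram_eq : ∀ a b, gram (a ᵥ* U.1) (b ᵥ* U.1) = gram a b
  height_pos : ∀ c, gram c c ≤ 0 → 0 < height c → 0 < height (c ᵥ* U.1)

/-- On the cone, `eight_mul_sq_le` keeps `c l / height c` within `(1 ± √3) / 4`, hence strictly
between -1/4 and 3/4. The new height vanishes at -1/4 for `swap l` and at 3/4 for `reflect l`. -/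
theorem isOrthochronous_swap (l : Fin 4) : IsOrthochronous (swap l) := by
  refine ⟨fun a b => gram_vecMul_swapMatrix a b l, fun c hc h0 => ?_⟩
  change 0 < height (c ᵥ* swapMatrix l)
  rw [height_vecMul_swapMatrix]
  have := eight_mul_sq_le c l
  by_contra hn
  nlinarith [mul_nonneg h0.le (sub_nonneg.2 (not_lt.1 hn))]

theorem isOrthochronous_reflect (l : Fin 4) : IsOrthochronous (reflect l) := by
  refine ⟨fun a b => gram_vecMul_swapMatrix_transpose a b l, fun c hc h0 => ?_⟩
  change 0 < height (c ᵥ* (swapMatrix l)ᵀ)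
  rw [height_vecMul_swapMatrix_transpose]
  have := eight_mul_sq_le c l
  by_contra hn
  nlinarith [mul_nonneg h0.le (sub_nonneg.2 (not_lt.1 hn))]

theorem vecMul_mul (a : Fin 4 → ℤ) (U V : GL (Fin 4) ℤ) :
    a ᵥ* (U * V).1 = a ᵥ* U.1 ᵥ* V.1 := by
  rw [Units.val_mul, Matrix.vecMul_vecMul]

theorem vecMul_vecMul_inv (a : Fin 4 → ℤ) (U : GL (Fin 4) ℤ) :
    a ᵥ* U.1 ᵥ* (U⁻¹).1 = a := by
  rw [← vecMul_mul, mul_inv_cancel, Units.val_one, Matrix.vecMul_one]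

theorem vecMul_inv_vecMul (a : Fin 4 → ℤ) (U : GL (Fin 4) ℤ) :
    a ᵥ* (U⁻¹).1 ᵥ* U.1 = a := by
  rw [← vecMul_mul, inv_mul_cancel, Units.val_one, Matrix.vecMul_one]

theorem IsOrthochronous.mul {U V : GL (Fin 4) ℤ} (hU : IsOrthochronous U)
    (hV : IsOrthochronous V) : IsOrthochronous (U * V) := by
  refine ⟨fun a b => ?_, fun c hc h0 => ?_⟩
  · rw [vecMul_mul, vecMul_mul, hV.gram_eq, hU.gram_eq]
  · rw [vecMul_mul]
    exact hV.height_pos _ (by rwa [hU.gram_eq]) (hU.height_pos c hc h0)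

theorem IsOrthochronous.inv {U : GL (Fin 4) ℤ} (hU : IsOrthochronous U) :
    IsOrthochronous U⁻¹ := by
  have hg : ∀ a b, gram (a ᵥ* (U⁻¹).1)
      (b ᵥ* (U⁻¹).1) = gram a b := fun a b => by
    rw [← hU.gram_eq, vecMul_inv_vecMul, vecMul_inv_vecMul]
  refine ⟨hg, fun c hc h0 => ?_⟩
  set d := c ᵥ* (U⁻¹).1 with hd
  have hdc : d ᵥ* U.1 = c := vecMul_inv_vecMul c U
  have hdg : gram d d ≤ 0 := by rwa [hd, hg]
  rcases lt_trichotomy (height d) 0 with h | h | h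
  · have := hU.height_pos (-d) (by rwa [gram_neg_neg]) (by rw [height_neg]; linarith)
    rw [Matrix.neg_vecMul, hdc, height_neg] at this
    linarith
  · rw [eq_zero_of_gram_nonpos hdg h, Matrix.zero_vecMul] at hdc
    rw [← hdc] at h0
    simp [height] at h0
  · exact h

theorem isOrthochronous_of_mem {U : GL (Fin 4) ℤ} (hU : U ∈ superApollonianGroup) :
    IsOrthochronous U := by
  induction hU using Subgroup.closure_induction with
  | mem x hx =>
    rcases hx with ⟨l, rfl⟩ | ⟨l, rfl⟩
    exacts [isOrthochronous_swap l, isOrthochronous_reflect l]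
  | one => exact ⟨fun a b => by simp, fun c _ h0 => by simpa using h0⟩
  | mul x y _ _ hx hy => exact hx.mul hy
  | inv x _ hx => exact hx.inv

theorem swap_mem (l : Fin 4) : swap l ∈ superApollonianGroup :=
  Subgroup.subset_closure (.inl ⟨l, rfl⟩)

theorem reflect_mem (l : Fin 4) : reflect l ∈ superApollonianGroup :=
  Subgroup.subset_closure (.inr ⟨l, rfl⟩)

theorem IsOrthochronous.isFuture {U : GL (Fin 4) ℤ} (hU : IsOrthochronous U) {c : Fin 4 → ℤ}
    (hc : IsFuture c) : IsFuture (c ᵥ* U.1) := by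
  refine ⟨by rw [hU.gram_eq]; exact hc.1, ?_⟩
  by_cases h : c = 0
  · simp [h, height]
  · exact (hU.height_pos c hc.1 (hc.height_pos h)).le

theorem vecMul_injective (U : GL (Fin 4) ℤ) :
    Function.Injective fun a : Fin 4 → ℤ => a ᵥ* U.1 :=
  Function.LeftInverse.injective (g := fun a => a ᵥ* (U⁻¹).1)
    fun a => vecMul_vecMul_inv a U

/-! ### Descent -/

theorem vecMul_swap_mem_roots {a : Fin 4 → ℤ} (ha : a ∈ roots) (l : Fin 4) :
    a ᵥ* (swap l).1 ∈ roots := by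
  refine ⟨by rw [(isOrthochronous_swap l).gram_eq]; exact ha.1, ?_⟩
  change 0 < height (a ᵥ* swapMatrix l)
  rw [height_vecMul_swapMatrix]
  have h1 := eight_mul_sq_le a l
  have h0 := ha.2
  rw [ha.1] at h1
  by_contra hn
  have h2 : a l ≤ -1 := by omega
  nlinarith [mul_nonneg h0.le (sub_nonneg.2 (not_lt.1 hn))]

/-- The reflection negates `e_l`, and this is the only root that leaves the positive side. A root
disjoint from `e_l` gains height; a root strictly inside `e_l` has height at least 3 by parity,
which is enough for `eight_mul_sq_le` to rule out a nonpositive new height. -/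
theorem vecMul_reflect_mem_roots {a : Fin 4 → ℤ} (ha : a ∈ roots) {l : Fin 4}
    (hne : a ≠ Pi.single l 1) : a ᵥ* (reflect l).1 ∈ roots := by
  have hg := (isOrthochronous_reflect l).gram_eq a a
  rw [ha.1] at hg
  refine ⟨hg, ?_⟩
  have hpar := odd_height hg
  change 0 < height (a ᵥ* (swapMatrix l)ᵀ)
  change Odd (height (a ᵥ* (swapMatrix l)ᵀ)) at hpar
  rw [height_vecMul_swapMatrix_transpose] at hpar ⊢
  have h0 := ha.2
  rcases gram_le_neg_one_or ha.1 (single_mem_roots l).1 with h | h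
  · rw [gram_single_right] at h
    omega
  · have h1 : height (Pi.single l 1) < height a := by
      refine (isFuture_sub_of_gram (single_mem_roots l) ha (by rwa [gram_comm]) ?_).height_lt
        hne.symm
      rw [height_single]; omega
    rw [height_single] at h1
    have h2 := eight_mul_sq_le a l
    rw [ha.1] at h2
    obtain ⟨k, hk⟩ := odd_height ha.1
    have h3 : 3 ≤ height a := by omega
    by_contra hn
    nlinarith [mul_nonneg h0.le (sub_nonneg.2 (not_lt.1 hn)), sq_nonneg (4 * a l - 3 * height a)]

/-- If all coordinates were between 0 and half the height, the norm would be nonpositive. The two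
alternatives are exactly the conditions under which `swap l`, respectively `reflect l`, lowers the
height. -/
theorem exists_neg_or_height_lt {a : Fin 4 → ℤ} (ha : a ∈ roots) :
    ∃ l, a l < 0 ∨ height a < 2 * a l := by
  by_contra! hn
  have h := ha.1
  have h1 : ∑ i, 2 * a i * a i ≤ ∑ i, height a * a i :=
    Finset.sum_le_sum fun i _ => mul_le_mul_of_nonneg_right (hn i).2 (hn i).1
  rw [← Finset.mul_sum] at h1
  simp only [mul_assoc, ← Finset.mul_sum] at h1
  rw [gram] at h
  change _ ≤ height a * height a at h1
  linarith

/-- Descent on the height ends at some `e_l`, which `reflect l` negates. The sign is what is needed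
later: with `a` reversed, the other three circles of the new configuration lie inside `a`. -/
theorem exists_single_vecMul_eq_neg {a : Fin 4 → ℤ} (ha : a ∈ roots) :
    ∃ U ∈ superApollonianGroup, ∃ i, Pi.single i 1 ᵥ* U.1 = -a := by
  induction hn : (height a).toNat using Nat.strong_induction_on generalizing a with
  | _ n ih =>
    obtain ⟨l, hl⟩ := exists_neg_or_height_lt ha
    by_cases he : a = Pi.single l 1
    · refine ⟨reflect l, reflect_mem l, l, ?_⟩
      ext j
      change (_ ᵥ* (swapMatrix l)ᵀ) j = _
      rw [vecMul_swapMatrix_transpose, he, height_single]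
      by_cases hj : j = l <;> simp [hj]
    have step : ∀ V ∈ superApollonianGroup, a ᵥ* V.1 ∈ roots →
        height (a ᵥ* V.1) < height a →
        ∃ U ∈ superApollonianGroup, ∃ i, Pi.single i 1 ᵥ* U.1 = -a := by
      intro V hV hr hlt
      obtain ⟨U, hU, i, hi⟩ := ih _ (by have := hr.2; have := ha.2; omega) hr rfl
      refine ⟨U * V⁻¹, mul_mem hU (inv_mem hV), i, ?_⟩
      rw [vecMul_mul, hi, Matrix.neg_vecMul, vecMul_vecMul_inv]
    rcases hl with hl | hl
    · refine step _ (swap_mem l) (vecMul_swap_mem_roots ha l) ?_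
      change height (a ᵥ* swapMatrix l) < _
      rw [height_vecMul_swapMatrix]; omega
    · refine step _ (reflect_mem l) (vecMul_reflect_mem_roots ha he) ?_
      change height (a ᵥ* (swapMatrix l)ᵀ) < _
      rw [height_vecMul_swapMatrix_transpose]; omega

/-! ### Outermost roots -/

/-- A root that lies inside no other root. -/
def IsOutermost (x : Fin 4 → ℤ) : Prop := x ∈ roots ∧ ∀ z ∈ roots, IsFuture (x - z) → z = x

theorem isOutermost_single (l : Fin 4) : IsOutermost (Pi.single l 1) := by
  refine ⟨single_mem_roots l, fun z hz h => ?_⟩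
  by_contra hne
  have := h.height_lt hne
  rw [height_single] at this
  have := hz.2
  omega

theorem isFuture_sub_single {x : Fin 4 → ℤ} (hx : x ∈ roots) {l : Fin 4}
    (h : 1 ≤ gram x (Pi.single l 1)) : IsFuture (x - Pi.single l 1) := by
  refine isFuture_sub_of_gram (single_mem_roots l) hx (by rwa [gram_comm]) ?_
  have := hx.2
  rw [height_single]
  omega

theorem IsOutermost.gram_single_le {x : Fin 4 → ℤ} (hx : IsOutermost x) {l : Fin 4}
    (hne : x ≠ Pi.single l 1) : gram x (Pi.single l 1) ≤ -1 := by
  refine (gram_le_neg_one_or hx.1.1 (single_mem_roots l).1).resolve_right fun h => hne ?_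
  exact (hx.2 _ (single_mem_roots l) (isFuture_sub_single hx.1 h)).symm

theorem swap_mul_swap (l : Fin 4) : swap l * swap l = 1 :=
  Units.ext (swapMatrix_mul_self l)

theorem vecMul_swap_vecMul_swap (a : Fin 4 → ℤ) (l : Fin 4) :
    a ᵥ* (swap l).1 ᵥ* (swap l).1 = a := by
  rw [← vecMul_mul, swap_mul_swap, Units.val_one, Matrix.vecMul_one]

theorem IsOutermost.vecMul_swap {x : Fin 4 → ℤ} (hx : IsOutermost x) (l : Fin 4) :
    IsOutermost (x ᵥ* (swap l).1) := by
  refine ⟨vecMul_swap_mem_roots hx.1 l, fun z hz h => ?_⟩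
  have h1 := (isOrthochronous_swap l).isFuture h
  rw [Matrix.sub_vecMul, vecMul_swap_vecMul_swap] at h1
  rw [← hx.2 _ (vecMul_swap_mem_roots hz l) h1, vecMul_swap_vecMul_swap]

theorem IsOutermost.vecMul {U : GL (Fin 4) ℤ} (hU : U ∈ apollonianGroup) :
    ∀ {x : Fin 4 → ℤ}, IsOutermost x → IsOutermost (x ᵥ* U.1) := by
  rw [apollonianGroup] at hU
  induction hU using Subgroup.closure_induction'' with
  | mem y hy => obtain ⟨l, rfl⟩ := hy; exact fun hx => hx.vecMul_swap l
  | inv_mem y hy =>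
    obtain ⟨l, rfl⟩ := hy
    rw [inv_eq_of_mul_eq_one_left (swap_mul_swap l)]
    exact fun hx => hx.vecMul_swap l
  | one => intro x hx; simpa using hx
  | mul y z _ _ hy hz => intro x hx; rw [vecMul_mul]; exact hz (hy hx)

/-- An outermost root other than `e_l` is disjoint from `e_l`, so `2 * x l < height x`. The descent
step by reflection never occurs, and the swaps keep the root outermost. -/
theorem IsOutermost.exists_single_vecMul_eq {x : Fin 4 → ℤ} (hx : IsOutermost x) :
    ∃ U ∈ apollonianGroup, ∃ i, Pi.single i 1 ᵥ* U.1 = x := by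
  induction hn : (height x).toNat using Nat.strong_induction_on generalizing x with
  | _ n ih =>
    by_cases he : ∃ l, x = Pi.single l 1
    · obtain ⟨l, rfl⟩ := he
      exact ⟨1, one_mem _, l, by simp⟩
    push Not at he
    obtain ⟨l, hl⟩ := exists_neg_or_height_lt hx.1
    have h1 := hx.gram_single_le (he l)
    rw [gram_single_right] at h1
    have h2 : x l < 0 := hl.resolve_right (by omega)
    have hs := hx.vecMul_swap l
    have h3 : height (x ᵥ* (swap l).1) = height x + 4 * x l :=
      height_vecMul_swapMatrix x l
    obtain ⟨U, hU, i, hi⟩ := ih _ (by have := hs.1.2; have := hx.1.2; omega) hs rfl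
    refine ⟨U * swap l, mul_mem hU (Subgroup.subset_closure ⟨l, rfl⟩), i, ?_⟩
    rw [vecMul_mul, hi, vecMul_swap_vecMul_swap]

theorem isOutermost_iff {x : Fin 4 → ℤ} :
    IsOutermost x ↔ ∃ U ∈ apollonianGroup, ∃ i, Pi.single i 1 ᵥ* U.1 = x := by
  refine ⟨IsOutermost.exists_single_vecMul_eq, ?_⟩
  rintro ⟨U, hU, i, rfl⟩
  exact (isOutermost_single i).vecMul hU

theorem infinite_isOutermost : {x | IsOutermost x}.Infinite := by
  intro hfin
  obtain ⟨x, hx, hmax⟩ := hfin.exists_maximalFor height _ ⟨_, isOutermost_single 0⟩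
  have hpos := hx.1.2
  obtain ⟨l, hl⟩ : ∃ l, 0 < x l := by
    by_contra! hn
    exact absurd hpos (not_lt.2 (Finset.sum_nonpos fun i _ => hn i))
  have h3 : height (x ᵥ* (swap l).1) = height x + 4 * x l :=
    height_vecMul_swapMatrix x l
  have := hmax (hx.vecMul_swap l) (by omega)
  omega

/-! ### Children of a root -/

/-- The root `b` lies inside the root `a`, and no root lies strictly between them. -/
structure IsChild (a b : Fin 4 → ℤ) : Prop where
  left_mem : a ∈ roots
  right_mem : b ∈ roots
  isFuture : IsFuture (b - a)
  ne : a ≠ b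
  eq_or_eq : ∀ y ∈ roots, IsFuture (b - y) → IsFuture (y - a) → y = a ∨ y = b

section children

variable {U : GL (Fin 4) ℤ} {a : Fin 4 → ℤ} {i : Fin 4}

theorem mem_roots_of_isFuture_add_single {z : Fin 4 → ℤ} (hz : gram z z = 1)
    (h : IsFuture (z + Pi.single i 1)) (hne : z ≠ -Pi.single i 1) : z ∈ roots := by
  obtain ⟨k, hk⟩ := odd_height hz
  have h0 := h.height_pos fun h => hne (eq_neg_of_add_eq_zero_left h)
  rw [height_add, height_single] at h0
  exact ⟨hz, by omega⟩

theorem neg_single_vecMul (hi : Pi.single i 1 ᵥ* U.1 = -a) :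
    (-Pi.single i 1 : Fin 4 → ℤ) ᵥ* U.1 = a := by
  rw [Matrix.neg_vecMul, hi, neg_neg]

/-- Translates "disjoint from `e_i`" before applying `U` into "inside `a`" afterwards. -/
theorem add_single_vecMul (hi : Pi.single i 1 ᵥ* U.1 = -a) (x : Fin 4 → ℤ) :
    (x + Pi.single i 1) ᵥ* U.1 = x ᵥ* U.1 - a := by
  rw [Matrix.add_vecMul, hi, sub_eq_add_neg]

theorem mem_roots_of_isFuture_sub {b : Fin 4 → ℤ} (ha : a ∈ roots) (hb : gram b b = 1)
    (h : IsFuture (b - a)) : b ∈ roots := by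
  refine ⟨hb, ?_⟩
  have := h.2
  rw [height_sub] at this
  have := ha.2
  omega

theorem IsOutermost.isChild (hU : IsOrthochronous U) (ha : a ∈ roots)
    (hi : Pi.single i 1 ᵥ* U.1 = -a) {x : Fin 4 → ℤ} (hx : IsOutermost x)
    (hne : x ≠ Pi.single i 1) : IsChild a (x ᵥ* U.1) := by
  have hf : IsFuture (x + Pi.single i 1) :=
    isFuture_add_of_gram hx.1 (single_mem_roots i) (hx.gram_single_le hne)
  have hf' := hU.isFuture hf
  rw [add_single_vecMul hi] at hf'
  refine ⟨ha, mem_roots_of_isFuture_sub ha (by rw [hU.gram_eq]; exact hx.1.1) hf', hf', ?_, ?_⟩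
  · intro h
    have h1 : (-Pi.single i 1 : Fin 4 → ℤ) ᵥ* U.1 = x ᵥ* U.1 := by
      rw [neg_single_vecMul hi, h]
    have h2 := hx.1.2
    rw [← vecMul_injective U h1, height_neg, height_single] at h2
    omega
  · intro y hy hby hya
    obtain ⟨z, rfl⟩ : ∃ z, z ᵥ* U.1 = y := ⟨_, vecMul_inv_vecMul y U⟩
    rw [← Matrix.sub_vecMul] at hby
    rw [← add_single_vecMul hi] at hya
    have h1 := hU.inv.isFuture hby
    have h2 := hU.inv.isFuture hya
    rw [vecMul_vecMul_inv] at h1 h2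
    -- Pulled back by `U`, a vector between `a` and the child is either `-e_i`, which corresponds to
    -- `a`, or a root enclosing the outermost root `x`.
    refine or_iff_not_imp_left.2 fun hya => ?_
    have hz := mem_roots_of_isFuture_add_single (by rw [← hU.gram_eq]; exact hy.1) h2
      (by rintro rfl; exact hya (neg_single_vecMul hi))
    rw [hx.2 z hz h1]

theorem IsChild.exists_isOutermost (hU : IsOrthochronous U)
    (hi : Pi.single i 1 ᵥ* U.1 = -a) {b : Fin 4 → ℤ} (hab : IsChild a b) :
    ∃ x, IsOutermost x ∧ x ≠ Pi.single i 1 ∧ x ᵥ* U.1 = b := by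
  obtain ⟨z, rfl⟩ : ∃ z, z ᵥ* U.1 = b := ⟨_, vecMul_inv_vecMul b U⟩
  have hzg : gram z z = 1 := by rw [← hU.gram_eq]; exact hab.right_mem.1
  have hza := hab.isFuture
  rw [← add_single_vecMul hi] at hza
  have hze := hU.inv.isFuture hza
  rw [vecMul_vecMul_inv] at hze
  have hz := mem_roots_of_isFuture_add_single hzg hze
    (by rintro rfl; exact hab.ne (neg_single_vecMul hi).symm)
  have hgram : gram z (Pi.single i 1) ≤ -1 := by
    have := hze.1
    rw [gram_add_self, hzg, (single_mem_roots i).1] at this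
    linarith
  refine ⟨z, ⟨hz, fun y hy hzy => ?_⟩, ?_, rfl⟩
  -- A root `y` around `z` that is disjoint from `e_i` is carried between `a` and its child, where
  -- only the child is possible. If instead `y` is inside `e_i`, then so is `z`, against `hgram`.
  · rcases gram_le_neg_one_or hy.1 (single_mem_roots i).1 with h | h
    · have h1 := hU.isFuture (isFuture_add_of_gram hy (single_mem_roots i) h)
      rw [add_single_vecMul hi] at h1
      have h2 := mem_roots_of_isFuture_sub hab.left_mem (by rw [hU.gram_eq]; exact hy.1) h1
      have h3 := hU.isFuture hzy
      rw [Matrix.sub_vecMul] at h3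
      rcases hab.eq_or_eq _ h2 h3 h1 with h4 | h4
      · have h5 : y ᵥ* U.1 = (-Pi.single i 1 : Fin 4 → ℤ) ᵥ* U.1 := by
          rw [neg_single_vecMul hi, h4]
        have h6 := hy.2
        rw [vecMul_injective U h5, height_neg, height_single] at h6
        omega
      · exact vecMul_injective U h4
    · have h1 := (hzy.sub_trans (isFuture_sub_single hy h)).one_le_gram (single_mem_roots i) hz
      rw [gram_comm] at h1
      omega
  · rintro rfl
    rw [(single_mem_roots i).1] at hgram
    omega

end children

/-! ### Ancestors and depth -/

/-- The roots other than `b` that enclose `b`. -/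
def ancestors (b : Fin 4 → ℤ) : Set (Fin 4 → ℤ) := {y | y ∈ roots ∧ y ≠ b ∧ IsFuture (b - y)}

/-- The roots with exactly `k` ancestors. -/
def rootsAtDepth (k : ℕ) : Set (Fin 4 → ℤ) := {b | b ∈ roots ∧ (ancestors b).encard = k}

theorem notMem_ancestors_self (a : Fin 4 → ℤ) : a ∉ ancestors a := fun h => h.2.1 rfl

theorem insert_ancestors_subset {a b : Fin 4 → ℤ} (ha : a ∈ roots) (hab : IsFuture (b - a))
    (hne : a ≠ b) : insert a (ancestors a) ⊆ ancestors b := by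
  rintro y (rfl | ⟨hy, hya, hf⟩)
  · exact ⟨ha, hne, hab⟩
  · refine ⟨hy, ?_, hab.sub_trans hf⟩
    rintro rfl
    exact hne (hab.antisymm hf)

theorem IsChild.ancestors_eq {a b : Fin 4 → ℤ} (h : IsChild a b) :
    ancestors b = insert a (ancestors a) := by
  refine Set.Subset.antisymm ?_ (insert_ancestors_subset h.left_mem h.isFuture h.ne)
  rintro y ⟨hy, hyb, hf⟩
  by_cases hya : y = a
  · exact .inl hya
  rcases isFuture_sub_or_sub h.left_mem hy h.right_mem h.isFuture hf with h' | h'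
  · exact .inl ((h.eq_or_eq y hy hf h').resolve_right hyb)
  · exact .inr ⟨hy, hya, h'⟩

theorem IsChild.encard_ancestors {a b : Fin 4 → ℤ} (h : IsChild a b) :
    (ancestors b).encard = (ancestors a).encard + 1 := by
  rw [h.ancestors_eq, Set.encard_insert_of_notMem (notMem_ancestors_self a)]

theorem IsChild.unique {a a' b : Fin 4 → ℤ} (h : IsChild a b) (h' : IsChild a' b) : a = a' := by
  rcases isFuture_sub_or_sub h.left_mem h'.left_mem h.right_mem h.isFuture h'.isFuture with hf | hf
  · exact ((h.eq_or_eq a' h'.left_mem h'.isFuture hf).resolve_right h'.ne).symm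
  · exact (h'.eq_or_eq a h.left_mem h.isFuture hf).resolve_right h.ne

theorem IsChild.mem_rootsAtDepth {a b : Fin 4 → ℤ} {k : ℕ} (h : IsChild a b)
    (ha : a ∈ rootsAtDepth k) : b ∈ rootsAtDepth (k + 1) := by
  refine ⟨h.right_mem, ?_⟩
  rw [h.encard_ancestors, ha.2]
  rfl

/-- The parent is the ancestor of greatest height; it exists because the given depth makes the set
of ancestors finite and nonempty. -/
theorem exists_isChild_of_mem_rootsAtDepth {b : Fin 4 → ℤ} {k : ℕ} (hb : b ∈ rootsAtDepth (k + 1)) :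
    ∃ a ∈ rootsAtDepth k, IsChild a b := by
  have hfin : (ancestors b).Finite := Set.finite_of_encard_eq_coe hb.2
  have hne : (ancestors b).Nonempty := by
    rw [← Set.encard_ne_zero, hb.2]
    exact_mod_cast Nat.succ_ne_zero k
  obtain ⟨a, ⟨har, hne, hf⟩, hmax⟩ := hfin.exists_maximalFor height _ hne
  have hch : IsChild a b := by
    refine ⟨har, hb.1, hf, hne, fun y hy hby hya => ?_⟩
    by_contra! hn
    have h1 := hya.height_lt hn.1.symm
    have h2 := hmax (j := y) ⟨hy, hn.2, hby⟩ h1.le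
    exact absurd h1 (not_lt.2 h2)
  refine ⟨a, ⟨har, ?_⟩, hch⟩
  have := hch.encard_ancestors
  rw [hb.2] at this
  push_cast at this
  exact (ENat.add_left_injective_of_ne_top (by simp) this).symm

theorem exists_isChild {a : Fin 4 → ℤ} (ha : a ∈ roots) : ∃ b, IsChild a b := by
  obtain ⟨U, hU, i, hi⟩ := exists_single_vecMul_eq_neg ha
  obtain ⟨j, hj⟩ := exists_ne i
  refine ⟨_, (isOutermost_single j).isChild (isOrthochronous_of_mem hU) ha hi fun h => hj ?_⟩
  by_contra hn
  simpa [hn] using congrFun h j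

theorem isOutermost_iff_mem_rootsAtDepth_zero {x : Fin 4 → ℤ} :
    IsOutermost x ↔ x ∈ rootsAtDepth 0 := by
  simp only [IsOutermost, rootsAtDepth, Set.mem_ofPred_eq, Nat.cast_zero, Set.encard_eq_zero,
    Set.eq_empty_iff_forall_notMem, ancestors]
  grind

theorem infinite_rootsAtDepth (k : ℕ) : (rootsAtDepth k).Infinite := by
  induction k with
  | zero =>
    convert infinite_isOutermost using 1
    ext x
    exact isOutermost_iff_mem_rootsAtDepth_zero.symm
  | succ k ih =>
    choose! f hf using fun a (ha : a ∈ roots) => exists_isChild ha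
    refine (ih.image (f := f) ?_).mono ?_
    · intro a ha a' ha' h
      exact (hf a ha.1).unique (h ▸ hf a' ha'.1)
    · rintro _ ⟨a, ha, rfl⟩
      exact (hf a ha.1).mem_rootsAtDepth ha

theorem isFuture_add_of_mem_rootsAtDepth {a b : Fin 4 → ℤ} {k : ℕ} (ha : a ∈ rootsAtDepth k)
    (hb : b ∈ rootsAtDepth k) (hne : a ≠ b) : IsFuture (a + b) := by
  have key : ∀ {a b : Fin 4 → ℤ}, a ∈ rootsAtDepth k → b ∈ rootsAtDepth k → a ≠ b →
      ¬ IsFuture (b - a) := by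
    intro a b ha hb hne hf
    have h := Set.encard_le_encard (insert_ancestors_subset ha.1 hf hne)
    rw [Set.encard_insert_of_notMem (notMem_ancestors_self a), ha.2, hb.2] at h
    have : k + 1 ≤ k := by exact_mod_cast h
    omega
  rcases isFuture_trichotomy ha.1 hb.1 with h | h | h
  · exact absurd h (key ha hb hne)
  · exact absurd h (key hb ha hne.symm)
  · exact h

/-! ### Circle vectors and points of the sphere -/

theorem circleFun_infty (v : Fin 4 → ℝ) : circleFun v (none : Option ℂ) = v 1 := rfl

theorem circleFun_coe (v : Fin 4 → ℝ) (z : ℂ) : circleFun v (some z : Option ℂ) =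
    v 1 * (z.re ^ 2 + z.im ^ 2) - 2 * (v 2 * z.re + v 3 * z.im) + v 0 := rfl

/-- The Lorentzian bilinear form on coordinate vectors. -/
noncomputable def form (v w : Fin 4 → ℝ) : ℝ := v 2 * w 2 + v 3 * w 3 - (v 0 * w 1 + v 1 * w 0) / 2

theorem isCircleVector_iff {v : Fin 4 → ℝ} : IsCircleVector v ↔ form v v = 1 := by
  rw [IsCircleVector, form]
  constructor <;> intro h <;> linarith

theorem form_comm (v w : Fin 4 → ℝ) : form v w = form w v := by
  simp only [form]; ring

theorem form_add_left (u v w : Fin 4 → ℝ) : form (u + v) w = form u w + form v w := by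
  simp only [form, Pi.add_apply]; ring

theorem form_neg_left (v w : Fin 4 → ℝ) : form (-v) w = -form v w := by
  simp only [form, Pi.neg_apply]; ring

/-- The null vector representing a point of the sphere. -/
noncomputable def nullVector : Sphere → Fin 4 → ℝ
  | none => ![1, 0, 0, 0]
  | some z => ![z.re ^ 2 + z.im ^ 2, 1, z.re, z.im]

theorem nullVector_infty : nullVector (none : Option ℂ) = ![1, 0, 0, 0] := rfl

theorem nullVector_coe (z : ℂ) :
    nullVector (some z : Option ℂ) = ![z.re ^ 2 + z.im ^ 2, 1, z.re, z.im] := rfl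

theorem circleFun_eq_form (v : Fin 4 → ℝ) (p : Sphere) :
    circleFun v p = -2 * form v (nullVector p) := by
  rcases p with _ | z
  · simp [circleFun_infty, nullVector_infty, form]; ring
  · simp [circleFun_coe, nullVector_coe, form]; ring

theorem form_nullVector_self (p : Sphere) : form (nullVector p) (nullVector p) = 0 := by
  rcases p with _ | z
  · simp [nullVector_infty, form]
  · simp [nullVector_coe, form]; ring

theorem nullVector_ne_zero (p : Sphere) : nullVector p ≠ 0 := by
  rcases p with _ | z
  · exact fun h => by simpa [nullVector_infty] using congrFun h 0
  · exact fun h => by simpa [nullVector_coe] using congrFun h 1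

theorem eq_of_form_nullVector {p q : Sphere} (h : form (nullVector p) (nullVector q) = 0) :
    p = q := by
  rcases p with _ | z <;> rcases q with _ | w
  · rfl
  · simp [nullVector_infty, nullVector_coe, form] at h
  · simp [nullVector_infty, nullVector_coe, form] at h
  · simp only [nullVector_coe, form, Matrix.cons_val] at h
    have h' : (z.re - w.re) ^ 2 + (z.im - w.im) ^ 2 = 0 := by linarith
    have h1 : z.re = w.re := by nlinarith [sq_nonneg (z.re - w.re), sq_nonneg (z.im - w.im)]
    have h2 : z.im = w.im := by nlinarith [sq_nonneg (z.re - w.re), sq_nonneg (z.im - w.im)]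
    rw [Complex.ext h1 h2]

theorem exists_nullVector {n : Fin 4 → ℝ} (h0 : n ≠ 0) (hn : form n n = 0) :
    ∃ (c : ℝ) (p : Sphere), c ≠ 0 ∧ n = c • nullVector p := by
  simp only [form] at hn
  by_cases h1 : n 1 = 0
  · rw [h1] at hn
    have h2 : n 2 = 0 := by nlinarith [sq_nonneg (n 2), sq_nonneg (n 3)]
    have h3 : n 3 = 0 := by nlinarith [sq_nonneg (n 2), sq_nonneg (n 3)]
    have e : n = n 0 • nullVector (none : Option ℂ) := by
      ext i
      fin_cases i <;> simp [nullVector_infty, h1, h2, h3]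
    refine ⟨n 0, none, fun h => h0 ?_, e⟩
    rw [e, h, zero_smul]
  · refine ⟨n 1, (some ⟨n 2 / n 1, n 3 / n 1⟩ : Option ℂ), h1, ?_⟩
    ext i
    fin_cases i <;> simp [nullVector_coe] <;> field_simp
    linarith

theorem form_smul_right (c : ℝ) (v w : Fin 4 → ℝ) : form v (c • w) = c * form v w := by
  simp only [form, Pi.smul_apply, smul_eq_mul]; ring

/-- The vector `v + w` is isotropic and orthogonal to both, so it represents a common point. Any
other common point would be orthogonal to it, which two distinct null directions never are. The case
`w = -v` must be excluded, since it also has product -1. -/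
theorem tangent_of_form_eq_neg_one {v w : Fin 4 → ℝ} (hv : IsCircleVector v)
    (hw : IsCircleVector w) (h : form v w = -1) (hne : v + w ≠ 0) :
    Tangent (circle v) (circle w) := by
  rw [isCircleVector_iff] at hv hw
  have e1 : form v (v + w) = 0 := by rw [form_comm, form_add_left, hv, form_comm, h]; norm_num
  have e2 : form w (v + w) = 0 := by rw [form_comm, form_add_left, hw, h]; norm_num
  obtain ⟨c, p, hc, hp⟩ := exists_nullVector hne (by rw [form_add_left, e1, e2, add_zero])
  rw [hp, form_smul_right] at e1 e2
  refine ⟨p, ⟨?_, ?_⟩, ?_⟩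
  · change circleFun v p = 0
    rw [circleFun_eq_form, (mul_eq_zero.1 e1).resolve_left hc, mul_zero]
  · change circleFun w p = 0
    rw [circleFun_eq_form, (mul_eq_zero.1 e2).resolve_left hc, mul_zero]
  · rintro q ⟨hq1, hq2⟩
    change circleFun v q = 0 at hq1
    change circleFun w q = 0 at hq2
    rw [circleFun_eq_form] at hq1 hq2
    refine eq_of_form_nullVector ?_
    have e3 : form (nullVector q) (v + w) = 0 := by
      rw [form_comm, form_add_left]; linarith
    rw [hp, form_smul_right] at e3
    exact (mul_eq_zero.1 e3).resolve_left hc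

theorem eq_or_eq_neg_of_circle_subset {v w : Fin 4 → ℝ} (hv : IsCircleVector v)
    (hw : IsCircleVector w) (h : circle w ⊆ circle v) : w = v ∨ w = -v := by
  rw [IsCircleVector] at hv hw
  have hfin (x y : ℝ) (hxy : w 1 * (x ^ 2 + y ^ 2) - 2 * (w 2 * x + w 3 * y) + w 0 = 0) :
      v 1 * (x ^ 2 + y ^ 2) - 2 * (v 2 * x + v 3 * y) + v 0 = 0 :=
    h (a := (some ⟨x, y⟩ : Option ℂ)) hxy
  have hinf (h1 : w 1 = 0) : v 1 = 0 := h (a := (none : Option ℂ)) h1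
  obtain ⟨t, ht⟩ : ∃ t : ℝ, v = t • w := by
    by_cases h1 : w 1 = 0
    · have hv1 := hinf h1
      rw [h1] at hw
      -- Test points on a line: the foot of the perpendicular from the origin, and that point moved
      -- by a unit along the line.
      have a1 := hfin (w 0 / 2 * w 2) (w 0 / 2 * w 3) (by rw [h1]; linear_combination (-w 0) * hw)
      have a2 := hfin (w 0 / 2 * w 2 - w 3) (w 0 / 2 * w 3 + w 2)
        (by rw [h1]; linear_combination (-w 0) * hw)
      rw [hv1] at a1 a2
      have a3 : v 2 * w 3 = v 3 * w 2 := by linear_combination (a2 - a1) / 2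
      refine ⟨v 2 * w 2 + v 3 * w 3, ?_⟩
      ext i
      fin_cases i <;> simp
      · linear_combination a1
      · rw [h1, hv1, mul_zero]
      · linear_combination (-v 2) * hw + w 3 * a3
      · linear_combination (-v 3) * hw - w 2 * a3
    · have key (s c : ℝ) (hsc : s ^ 2 + c ^ 2 = 1) := hfin ((w 2 + s) / w 1) ((w 3 + c) / w 1) (by
        field_simp
        linear_combination hsc - hw)
      -- Test points on a genuine circle: the ends of the horizontal and the vertical diameter.
      have k1 := key 1 0 (by norm_num)
      have k2 := key (-1) 0 (by norm_num)
      have k3 := key 0 1 (by norm_num)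
      have k4 := key 0 (-1) (by norm_num)
      refine ⟨v 1 / w 1, ?_⟩
      field_simp at k1 k2 k3 k4
      have b2 : v 2 * w 1 = v 1 * w 2 := by linear_combination (k2 - k1) / 4
      have b3 : v 3 * w 1 = v 1 * w 3 := by linear_combination (k4 - k3) / 4
      ext i
      fin_cases i <;> simp
      · field_simp
        have : w 1 * (w 1 * v 0 - v 1 * w 0) = 0 := by
          linear_combination (k1 + k2) / 2 + 2 * w 2 * b2 + 2 * w 3 * b3 + v 1 * hw
        linarith [(mul_eq_zero.1 this).resolve_left h1]
      · field_simp
      · field_simp; linarith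
      · field_simp; linarith
  have ht2 : (t - 1) * (t + 1) = 0 := by
    rw [ht] at hv
    simp only [Pi.smul_apply, smul_eq_mul] at hv
    linear_combination hv - t ^ 2 * hw
  rcases mul_eq_zero.1 ht2 with h' | h'
  · left; rw [ht, sub_eq_zero.1 h', one_smul]
  · right; rw [ht, eq_neg_of_add_eq_zero_left h', neg_one_smul, neg_neg]

/-- If two circles have parallel but distinct unit normals `(α, β)` and `(γ, δ)` at a common point,
then their vectors have product `-1`. -/
theorem form_eq_neg_one_of_normals {v w : Fin 4 → ℝ} {α β γ δ : ℝ} (h1 : α ^ 2 + β ^ 2 = 1)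
    (h2 : γ ^ 2 + δ ^ 2 = 1) (hf : form v w = α * γ + β * δ) (hdet : α * δ - β * γ = 0)
    (hne : ¬ (α = γ ∧ β = δ)) : form v w = -1 := by
  rw [hf]
  have : (α * γ + β * δ - 1) * (α * γ + β * δ + 1) = 0 := by
    linear_combination (γ ^ 2 + δ ^ 2) * h1 + h2 - (α * δ - β * γ) * hdet
  rcases mul_eq_zero.1 this with h | h
  · refine absurd ⟨?_, ?_⟩ hne
    · nlinarith [sq_nonneg (α - γ), sq_nonneg (β - δ)]
    · nlinarith [sq_nonneg (α - γ), sq_nonneg (β - δ)]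
  · linarith

/-- The product is the scalar product of the inner unit normals at the common point. Normals that
are not parallel produce a second common point, and equal normals make the interiors overlap;
opposite normals remain. -/
theorem form_eq_neg_one_of_tangent {v w : Fin 4 → ℝ} (hv : IsCircleVector v)
    (hw : IsCircleVector w) (ht : Tangent (circle v) (circle w))
    (hd : Disjoint (disc v) (disc w)) : form v w = -1 := by
  rw [IsCircleVector] at hv hw
  obtain ⟨p, ⟨hpv, hpw⟩, huniq⟩ := ht
  have hdfin (x y : ℝ) (hx : v 1 * (x ^ 2 + y ^ 2) - 2 * (v 2 * x + v 3 * y) + v 0 < 0)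
      (hy : w 1 * (x ^ 2 + y ^ 2) - 2 * (w 2 * x + w 3 * y) + w 0 < 0) : False :=
    Set.disjoint_left.1 hd (show (some ⟨x, y⟩ : Option ℂ) ∈ disc v from hx) hy
  have hcfin (x y : ℝ) (hx : v 1 * (x ^ 2 + y ^ 2) - 2 * (v 2 * x + v 3 * y) + v 0 = 0)
      (hy : w 1 * (x ^ 2 + y ^ 2) - 2 * (w 2 * x + w 3 * y) + w 0 = 0) :
      (some ⟨x, y⟩ : Option ℂ) = p := huniq (some ⟨x, y⟩ : Option ℂ) ⟨hx, hy⟩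
  have hcinf (hx : v 1 = 0) (hy : w 1 = 0) : (none : Option ℂ) = p :=
    huniq (none : Option ℂ) ⟨hx, hy⟩
  rcases p with _ | z
  · change v 1 = 0 at hpv
    change w 1 = 0 at hpw
    rw [hpv] at hv
    rw [hpw] at hw
    refine form_eq_neg_one_of_normals (α := v 2) (β := v 3) (γ := w 2) (δ := w 3)
      (by linarith) (by linarith) (by rw [form, hpv, hpw]; ring) ?_ ?_
    · by_contra hdet
      set D := v 2 * w 3 - v 3 * w 2 with hD
      have := hcfin ((v 0 * w 3 - w 0 * v 3) / (2 * D)) ((v 2 * w 0 - w 2 * v 0) / (2 * D))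
        (by rw [hpv]; field_simp; rw [hD]; ring) (by rw [hpw]; field_simp; rw [hD]; ring)
      cases this
    · rintro ⟨e1, e2⟩
      rw [e1, e2, hpv] at hdfin
      rw [hpw] at hdfin
      have a1 := le_abs_self (v 0)
      have a2 := le_abs_self (w 0)
      have a3 := abs_nonneg (v 0)
      have a4 := abs_nonneg (w 0)
      have hs : w 2 * ((|v 0| + |w 0| + 1) * w 2) + w 3 * ((|v 0| + |w 0| + 1) * w 3)
          = |v 0| + |w 0| + 1 := by linear_combination (|v 0| + |w 0| + 1) * hw
      refine hdfin ((|v 0| + |w 0| + 1) * w 2) ((|v 0| + |w 0| + 1) * w 3) ?_ ?_ <;>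
        rw [hs] <;> linarith
  · change v 1 * (z.re ^ 2 + z.im ^ 2) - 2 * (v 2 * z.re + v 3 * z.im) + v 0 = 0 at hpv
    change w 1 * (z.re ^ 2 + z.im ^ 2) - 2 * (w 2 * z.re + w 3 * z.im) + w 0 = 0 at hpw
    obtain ⟨x, y⟩ := z
    dsimp only at hpv hpw
    -- `(α, β)` and `(γ, δ)` are the inner unit normals at the common point `(x, y)`.
    obtain ⟨α, hα⟩ : ∃ α, v 2 = α + v 1 * x := ⟨v 2 - v 1 * x, by ring⟩
    obtain ⟨β, hβ⟩ : ∃ β, v 3 = β + v 1 * y := ⟨v 3 - v 1 * y, by ring⟩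
    obtain ⟨γ, hγ⟩ : ∃ γ, w 2 = γ + w 1 * x := ⟨w 2 - w 1 * x, by ring⟩
    obtain ⟨δ, hδ⟩ : ∃ δ, w 3 = δ + w 1 * y := ⟨w 3 - w 1 * y, by ring⟩
    have hv0 : v 0 = v 1 * (x ^ 2 + y ^ 2) + 2 * (α * x + β * y) := by
      rw [hα, hβ] at hpv; linarith
    have hw0 : w 0 = w 1 * (x ^ 2 + y ^ 2) + 2 * (γ * x + δ * y) := by
      rw [hγ, hδ] at hpw; linarith
    have n1 : α ^ 2 + β ^ 2 = 1 := by rw [hα, hβ, hv0] at hv; linarith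
    have n2 : γ ^ 2 + δ ^ 2 = 1 := by rw [hγ, hδ, hw0] at hw; linarith
    have ev (s t : ℝ) : v 1 * ((x + s) ^ 2 + (y + t) ^ 2) - 2 * (v 2 * (x + s) + v 3 * (y + t))
        + v 0 = v 1 * (s ^ 2 + t ^ 2) - 2 * (α * s + β * t) := by rw [hα, hβ, hv0]; ring
    have ew (s t : ℝ) : w 1 * ((x + s) ^ 2 + (y + t) ^ 2) - 2 * (w 2 * (x + s) + w 3 * (y + t))
        + w 0 = w 1 * (s ^ 2 + t ^ 2) - 2 * (γ * s + δ * t) := by rw [hγ, hδ, hw0]; ring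
    refine form_eq_neg_one_of_normals n1 n2 (by rw [form, hα, hβ, hγ, hδ, hv0, hw0]; ring) ?_ ?_
    · by_contra hdet
      set D := α * δ - β * γ with hD
      -- Inversion centered at the common point turns the circles into lines, and `(a, b)` is their
      -- intersection by Cramer's rule. Inverting back gives the second common point, which is `∞`
      -- if `a = b = 0`.
      obtain ⟨a, ha⟩ : ∃ a, a = (v 1 * δ - w 1 * β) / (2 * D) := ⟨_, rfl⟩
      obtain ⟨b, hb⟩ : ∃ b, b = (α * w 1 - γ * v 1) / (2 * D) := ⟨_, rfl⟩
      have s1 : 2 * (α * a + β * b) = v 1 := by rw [ha, hb]; field_simp; rw [hD]; ring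
      have s2 : 2 * (γ * a + δ * b) = w 1 := by rw [ha, hb]; field_simp; rw [hD]; ring
      by_cases h0 : a ^ 2 + b ^ 2 = 0
      · have ha0 : a = 0 := pow_eq_zero_iff two_ne_zero |>.1
          (le_antisymm (h0 ▸ le_add_of_nonneg_right (sq_nonneg b)) (sq_nonneg a))
        have hb0 : b = 0 := pow_eq_zero_iff two_ne_zero |>.1
          (le_antisymm (h0 ▸ le_add_of_nonneg_left (sq_nonneg a)) (sq_nonneg b))
        have := hcinf (by rw [← s1, ha0, hb0]; ring) (by rw [← s2, ha0, hb0]; ring)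
        cases this
      · have := hcfin (x + a / (a ^ 2 + b ^ 2)) (y + b / (a ^ 2 + b ^ 2))
          (by rw [ev, ← s1]; field_simp; ring) (by rw [ew, ← s2]; field_simp; ring)
        have e := Option.some.inj this
        have e1 : x + a / (a ^ 2 + b ^ 2) = x := congrArg Complex.re e
        have e2 : y + b / (a ^ 2 + b ^ 2) = y := congrArg Complex.im e
        have e1' := (div_eq_zero_iff.1 (add_eq_left.1 e1)).resolve_right h0
        have e2' := (div_eq_zero_iff.1 (add_eq_left.1 e2)).resolve_right h0
        exact h0 (by rw [e1', e2']; ring)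
    · rintro ⟨rfl, rfl⟩
      -- A step of length `ε` along the common normal stays inside both discs: the values there are
      -- at most `ε - 2 * ε`.
      obtain ⟨ε, hε0, hεe⟩ : ∃ ε : ℝ, 0 < ε ∧ (|v 1| + |w 1| + 1) * ε = 1 :=
        ⟨(|v 1| + |w 1| + 1)⁻¹, by positivity, mul_inv_cancel₀ (by positivity)⟩
      have b1 : v 1 * ε ≤ 1 := hεe ▸ mul_le_mul_of_nonneg_right
        (by linarith [le_abs_self (v 1), abs_nonneg (w 1)]) hε0.le
      have b2 : w 1 * ε ≤ 1 := hεe ▸ mul_le_mul_of_nonneg_right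
        (by linarith [le_abs_self (w 1), abs_nonneg (v 1)]) hε0.le
      have es : (ε * α) ^ 2 + (ε * β) ^ 2 = ε ^ 2 := by linear_combination ε ^ 2 * n1
      have el : α * (ε * α) + β * (ε * β) = ε := by linear_combination ε * n1
      refine hdfin (x + ε * α) (y + ε * β) ?_ ?_
      · rw [ev, es, el]; nlinarith [mul_le_mul_of_nonneg_right b1 hε0.le]
      · rw [ew, es, el]; nlinarith [mul_le_mul_of_nonneg_right b2 hε0.le]

/-! ### Coordinates with respect to a Descartes configuration -/

/-- The vector with integer coordinates `a` with respect to the rows of `W`. -/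
def combination (W : Matrix (Fin 4) (Fin 4) ℝ) (a : Fin 4 → ℤ) : Fin 4 → ℝ :=
  (fun j => (a j : ℝ)) ᵥ* W

theorem combination_apply (W : Matrix (Fin 4) (Fin 4) ℝ) (a : Fin 4 → ℤ) (c : Fin 4) :
    combination W a c = ∑ j, (a j : ℝ) * W j c := rfl

theorem circleFun_combination (W : Matrix (Fin 4) (Fin 4) ℝ) (a : Fin 4 → ℤ) (p : Sphere) :
    circleFun (combination W a) p = ∑ j, (a j : ℝ) * circleFun (W j) p := by
  rcases p with _ | z
  · simp only [circleFun_infty, combination_apply]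
  · simp only [circleFun_coe, combination_apply, Fin.sum_univ_four]; ring

theorem combination_neg (W : Matrix (Fin 4) (Fin 4) ℝ) (a : Fin 4 → ℤ) :
    combination W (-a) = -combination W a := by
  ext c
  simp [combination_apply]

theorem combination_add (W : Matrix (Fin 4) (Fin 4) ℝ) (a b : Fin 4 → ℤ) :
    combination W (a + b) = combination W a + combination W b := by
  ext c
  simp [combination_apply, add_mul, Finset.sum_add_distrib]

theorem combination_single (W : Matrix (Fin 4) (Fin 4) ℝ) (i : Fin 4) :
    combination W (Pi.single i 1) = W i := by
  ext c
  simp [combination_apply, Pi.single_apply]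

theorem act_apply (U : GL (Fin 4) ℤ) (W : Matrix (Fin 4) (Fin 4) ℝ) (i : Fin 4) :
    act U W i = combination W (Pi.single i 1 ᵥ* U.1) := by
  rw [Matrix.single_one_vecMul]
  rfl

theorem act_mul (U V : GL (Fin 4) ℤ) (W : Matrix (Fin 4) (Fin 4) ℝ) :
    act (U * V) W = act U (act V W) := by
  simp only [act, Units.val_mul]
  rw [← Matrix.mul_assoc]
  congr 1
  exact Matrix.map_mul (f := Int.castRingHom ℝ)

theorem circle_neg (v : Fin 4 → ℝ) : circle (-v) = circle v := by
  ext p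
  change circleFun (-v) p = 0 ↔ circleFun v p = 0
  rw [circleFun_eq_form, circleFun_eq_form, form_neg_left]
  simp

section

variable {W : Matrix (Fin 4) (Fin 4) ℝ}

theorem IsDescartes.form_self (hW : IsDescartes W) (i : Fin 4) : form (W i) (W i) = 1 :=
  isCircleVector_iff.1 (hW.isCircleVector i)

theorem IsDescartes.form_ne (hW : IsDescartes W) {i j : Fin 4} (h : i ≠ j) :
    form (W i) (W j) = -1 :=
  form_eq_neg_one_of_tangent (hW.isCircleVector i) (hW.isCircleVector j) (hW.tangent i j h)
    (hW.disjoint_interiors i j h)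

theorem IsDescartes.form_combination (hW : IsDescartes W) (a b : Fin 4 → ℤ) :
    form (combination W a) (combination W b) = gram a b := by
  have e : form (combination W a) (combination W b)
      = ∑ i, ∑ j, (a i : ℝ) * b j * form (W i) (W j) := by
    simp only [form, combination_apply, Fin.sum_univ_four]; ring
  have e2 : ∀ i j, form (W i) (W j) = 2 * (if i = j then 1 else 0) - 1 := by
    intro i j
    split_ifs with h
    · rw [h, hW.form_self]; norm_num
    · rw [hW.form_ne h]; norm_num
  rw [e]
  simp only [e2, gram, height, Fin.sum_univ_four]
  simp
  ring

theorem IsDescartes.isCircleVector_combination (hW : IsDescartes W) {a : Fin 4 → ℤ}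
    (ha : gram a a = 1) : IsCircleVector (combination W a) := by
  rw [isCircleVector_iff, hW.form_combination, ha, Int.cast_one]

theorem IsDescartes.combination_injective (hW : IsDescartes W) :
    Function.Injective (combination W) := by
  have key : ∀ c, combination W c = 0 → c = 0 := by
    intro c hc
    have h (d) : gram c d = 0 := by
      have := hW.form_combination c d
      rw [hc] at this
      simp only [form, Pi.zero_apply] at this
      have h' : (gram c d : ℝ) = 0 := by linarith
      exact_mod_cast h'
    have h1 (i) := h (Pi.single i 1)
    simp only [gram_single_right] at h1
    have h2 : height c = 0 := by
      have e : height c = c 0 + c 1 + c 2 + c 3 := by simp [height, Fin.sum_univ_four]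
      have := h1 0
      have := h1 1
      have := h1 2
      have := h1 3
      omega
    exact eq_zero_of_gram_nonpos (h c).le h2
  intro a b hab
  refine sub_eq_zero.1 (key _ ?_)
  rw [sub_eq_add_neg, combination_add, combination_neg, hab, add_neg_cancel]

/-! ### Points of the sphere as vectors of the cone -/

/-- The matrix of the Lorentzian form. -/
noncomputable def formMatrix : Matrix (Fin 4) (Fin 4) ℝ :=
  !![0, -1 / 2, 0, 0; -1 / 2, 0, 0, 0; 0, 0, 1, 0; 0, 0, 0, 1]

theorem form_eq_dotProduct (v w : Fin 4 → ℝ) : form v w = v ⬝ᵥ formMatrix *ᵥ w := by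
  simp [form, formMatrix, Matrix.mulVec, dotProduct, Fin.sum_univ_four]
  ring

/-- The inverse of the Gram matrix of a Descartes configuration. -/
noncomputable def gramInv : Matrix (Fin 4) (Fin 4) ℝ :=
  Matrix.of fun i j => (if i = j then 1 / 2 else 0) - 1 / 4

/-- The Descartes circle theorem. -/
theorem IsDescartes.transpose_mul_gramInv_mul (hW : IsDescartes W) :
    Wᵀ * gramInv * W * formMatrix = 1 := by
  have h1 : W * formMatrix * Wᵀ = Matrix.of fun i j => (if i = j then 2 else 0) - 1 := by
    ext i j
    have e : (W * formMatrix * Wᵀ) i j = form (W i) (W j) := by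
      rw [form_eq_dotProduct, Matrix.mul_assoc, Matrix.mul_apply_eq_vecMul]
      simp only [Matrix.vecMul, dotProduct, Matrix.mulVec, Matrix.mul_apply, Matrix.transpose_apply]
    rw [e]
    by_cases h : i = j
    · subst h; rw [hW.form_self]; norm_num
    · rw [hW.form_ne h]; simp [h]
  have h2 : W * (formMatrix * Wᵀ * gramInv) = 1 := by
    rw [← Matrix.mul_assoc, ← Matrix.mul_assoc, h1]
    ext i j
    simp only [gramInv, Matrix.mul_apply, Matrix.of_apply, Fin.sum_univ_four]
    fin_cases i <;> fin_cases j <;> norm_num [Fin.ext_iff]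
  have h3 : formMatrix * (Wᵀ * gramInv * W) = 1 := by
    rw [mul_eq_one_comm] at h2
    rw [← h2]
    simp only [Matrix.mul_assoc]
  rwa [mul_eq_one_comm] at h3

/-- The null vector of `p` is isotropic, and by the Descartes circle theorem its products with the
rows of `W` are then isotropic for the inverse Gram matrix. -/
theorem IsDescartes.circleFun_quadratic (hW : IsDescartes W) (p : Sphere) :
    2 * ∑ j, circleFun (W j) p ^ 2 = (∑ j, circleFun (W j) p) ^ 2 := by
  have h := hW.transpose_mul_gramInv_mul
  set n := nullVector p
  set y := W *ᵥ (formMatrix *ᵥ n) with hy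
  have h1 : Wᵀ *ᵥ (gramInv *ᵥ y) = n := by
    simp only [hy, Matrix.mulVec_mulVec, ← Matrix.mul_assoc]
    rw [h, Matrix.one_mulVec]
  have h2 : y ⬝ᵥ gramInv *ᵥ y = 0 := by
    have h3 : form n n = 0 := form_nullVector_self p
    have h4 : form n n = (Wᵀ *ᵥ (gramInv *ᵥ y)) ⬝ᵥ formMatrix *ᵥ n := by
      rw [h1, form_eq_dotProduct]
    rw [Matrix.mulVec_transpose, ← Matrix.dotProduct_mulVec, dotProduct_comm] at h4
    rw [← h3, h4]
  have hf : ∀ j, circleFun (W j) p = -2 * y j := fun j => by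
    rw [circleFun_eq_form, form_eq_dotProduct]; rfl
  simp only [hf]
  simp [gramInv, Matrix.mulVec, dotProduct, Fin.sum_univ_four] at h2 ⊢
  linear_combination 16 * h2

/-- Disjointness of the interiors fixes the time orientation: at most one value is negative, say
`-m`. If the others had sum at most `m`, the square of the total would be at most `m ^ 2`, against
`circleFun_quadratic`. -/
theorem IsDescartes.circleFun_sum_pos (hW : IsDescartes W) (p : Sphere) :
    0 < ∑ j, circleFun (W j) p := by
  have hq := hW.circleFun_quadratic p
  have hne : ∃ j, circleFun (W j) p ≠ 0 := by
    by_contra! hn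
    refine nullVector_ne_zero p ?_
    have hy : W *ᵥ (formMatrix *ᵥ nullVector p) = 0 := by
      ext j
      have := hn j
      rw [circleFun_eq_form, form_eq_dotProduct] at this
      exact (mul_eq_zero.1 this).resolve_left (by norm_num)
    have h := congrArg (· *ᵥ nullVector p) hW.transpose_mul_gramInv_mul
    simp only [← Matrix.mulVec_mulVec, hy, Matrix.mulVec_zero, Matrix.one_mulVec] at h
    exact h.symm
  have hsum : 0 < ∑ j, circleFun (W j) p ^ 2 := by
    obtain ⟨j, hj⟩ := hne
    exact Finset.sum_pos' (fun i _ => sq_nonneg _) ⟨j, Finset.mem_univ j, by positivity⟩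
  by_contra hs
  obtain ⟨i, hi⟩ : ∃ i, circleFun (W i) p < 0 := by
    by_contra! hn
    have h0 := le_antisymm (not_lt.1 hs) (Finset.sum_nonneg fun i _ => hn i)
    rw [h0] at hq
    linarith
  have hj : ∀ j, j ≠ i → 0 ≤ circleFun (W j) p := fun j hji => by
    by_contra hj
    exact Set.disjoint_left.1 (hW.disjoint_interiors i j hji.symm) hi (not_le.1 hj)
  have e := Finset.add_sum_erase Finset.univ (fun j => circleFun (W j) p) (Finset.mem_univ i)
  have e2 := Finset.add_sum_erase Finset.univ (fun j => circleFun (W j) p ^ 2) (Finset.mem_univ i)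
  have hr : 0 ≤ ∑ j ∈ Finset.univ.erase i, circleFun (W j) p :=
    Finset.sum_nonneg fun j hj' => hj j (Finset.ne_of_mem_erase hj')
  have hr2 : 0 ≤ ∑ j ∈ Finset.univ.erase i, circleFun (W j) p ^ 2 :=
    Finset.sum_nonneg fun j _ => sq_nonneg _
  nlinarith

theorem IsDescartes.circleFun_nonneg (hW : IsDescartes W) {c : Fin 4 → ℤ} (hc : IsFuture c)
    (p : Sphere) : 0 ≤ circleFun (combination W c) p := by
  rw [circleFun_combination]
  have := (abs_le.1 (abs_four_mul_sum_sub_le hc.cast.1 (hW.circleFun_quadratic p).le hc.cast.2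
    (hW.circleFun_sum_pos p).le)).1
  linarith

theorem circleFun_combination_add (W : Matrix (Fin 4) (Fin 4) ℝ) (a b : Fin 4 → ℤ) (p : Sphere) :
    circleFun (combination W (a + b)) p
      = circleFun (combination W a) p + circleFun (combination W b) p := by
  rw [combination_add, circleFun_eq_form, circleFun_eq_form, circleFun_eq_form, form_add_left]
  ring

theorem IsDescartes.circleFun_le (hW : IsDescartes W) {a b : Fin 4 → ℤ} (h : IsFuture (b - a))
    (p : Sphere) : circleFun (combination W a) p ≤ circleFun (combination W b) p := by
  have h1 := hW.circleFun_nonneg h p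
  have h2 := circleFun_combination_add W a (b - a) p
  rw [add_sub_cancel] at h2
  linarith

theorem IsDescartes.disjoint_disc (hW : IsDescartes W) {a b : Fin 4 → ℤ} (h : IsFuture (a + b)) :
    Disjoint (disc (combination W a)) (disc (combination W b)) := by
  rw [Set.disjoint_left]
  intro p hp hp'
  change circleFun _ p < 0 at hp hp'
  have h1 := hW.circleFun_nonneg h p
  rw [circleFun_combination_add] at h1
  linarith

theorem IsDescartes.eq_of_circle_subset (hW : IsDescartes W) {a b : Fin 4 → ℤ} (ha : a ∈ roots)
    (hb : b ∈ roots) (h : circle (combination W b) ⊆ circle (combination W a)) : a = b := by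
  rcases eq_or_eq_neg_of_circle_subset (hW.isCircleVector_combination ha.1)
    (hW.isCircleVector_combination hb.1) h with h | h
  · exact hW.combination_injective h.symm
  · rw [← combination_neg] at h
    have h1 := hb.2
    rw [hW.combination_injective h, height_neg] at h1
    exact absurd ha.2 (by omega)

theorem IsDescartes.act_of_mem (hW : IsDescartes W) {U : GL (Fin 4) ℤ}
    (hU : U ∈ superApollonianGroup) : IsDescartes (act U W) := by
  have ho := isOrthochronous_of_mem hU
  have hadd : ∀ i j : Fin 4, Pi.single i 1 ᵥ* U.1 + Pi.single j 1 ᵥ* U.1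
      = (Pi.single i 1 + Pi.single j 1 : Fin 4 → ℤ) ᵥ* U.1 := fun i j => by rw [Matrix.add_vecMul]
  have hc : ∀ i, IsCircleVector (act U W i) := fun i => by
    rw [act_apply]
    exact hW.isCircleVector_combination (by rw [ho.gram_eq]; exact (single_mem_roots i).1)
  have hf : ∀ i j : Fin 4, i ≠ j → IsFuture (Pi.single i 1 ᵥ* U.1 + Pi.single j 1 ᵥ* U.1) :=
    fun i j hij => by
      rw [hadd]
      exact ho.isFuture (isFuture_add_of_gram (single_mem_roots i) (single_mem_roots j)
        (gram_single_single hij).le)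
  refine ⟨hc, fun i j hij => ?_, fun i j hij => ?_⟩
  · refine tangent_of_form_eq_neg_one (hc i) (hc j) ?_ ?_
    · rw [act_apply, act_apply, hW.form_combination, ho.gram_eq, gram_single_single hij]
      norm_num
    · rw [act_apply, act_apply, ← combination_add, hadd]
      intro h0
      have h1 : (Pi.single i 1 + Pi.single j 1 : Fin 4 → ℤ) ᵥ* U.1 = 0 ᵥ* U.1 := by
        refine hW.combination_injective (h0.trans ?_)
        rw [Matrix.zero_vecMul]
        ext c
        simp [combination_apply]
      have h2 := congrArg height (vecMul_injective U h1)
      rw [height_add, height_single, height_single] at h2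
      simp [height] at h2
  · rw [act_apply, act_apply]
    exact hW.disjoint_disc (hf i j hij)

/-! ### The super-packing in coordinates -/

/-- Not all circles of the generating configuration lie in the closed disc of a root. -/
theorem IsDescartes.exists_circleFun_pos (hW : IsDescartes W) {a : Fin 4 → ℤ} (ha : a ∈ roots) :
    ∃ i, ∃ p ∈ circle (W i), 0 < circleFun (combination W a) p := by
  have hh : height a = a 0 + a 1 + a 2 + a 3 := by simp [height, Fin.sum_univ_four]
  have hpos := ha.2
  -- At the tangency point of two circles of `W`, `circleFun_quadratic` makes the other two values
  -- equal, and they are positive. The sign of the value for `a` is then that of a sum of two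
  -- coordinates; one of the two complementary sums is positive.
  rcases lt_or_ge 0 (a 0 + a 1) with h | h
  · obtain ⟨p, ⟨hp, hp'⟩, -⟩ := hW.tangent 2 3 (by decide)
    refine ⟨2, p, hp, ?_⟩
    change circleFun (W 2) p = 0 at hp
    change circleFun (W 3) p = 0 at hp'
    have hq := hW.circleFun_quadratic p
    have hs := hW.circleFun_sum_pos p
    rw [circleFun_combination]
    simp only [Fin.sum_univ_four, hp, hp'] at hq hs ⊢
    have e : circleFun (W 0) p = circleFun (W 1) p := by
      have : (circleFun (W 0) p - circleFun (W 1) p) ^ 2 = 0 := by linarith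
      exact sub_eq_zero.1 (pow_eq_zero_iff two_ne_zero |>.1 this)
    have h' : (0 : ℝ) < a 0 + a 1 := by exact_mod_cast h
    rw [e] at hs ⊢
    nlinarith
  · have h : 0 < a 2 + a 3 := by omega
    obtain ⟨p, ⟨hp, hp'⟩, -⟩ := hW.tangent 0 1 (by decide)
    refine ⟨0, p, hp, ?_⟩
    change circleFun (W 0) p = 0 at hp
    change circleFun (W 1) p = 0 at hp'
    have hq := hW.circleFun_quadratic p
    have hs := hW.circleFun_sum_pos p
    rw [circleFun_combination]
    simp only [Fin.sum_univ_four, hp, hp'] at hq hs ⊢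
    have e : circleFun (W 2) p = circleFun (W 3) p := by
      have : (circleFun (W 2) p - circleFun (W 3) p) ^ 2 = 0 := by linarith
      exact sub_eq_zero.1 (pow_eq_zero_iff two_ne_zero |>.1 this)
    have h' : (0 : ℝ) < a 2 + a 3 := by exact_mod_cast h
    rw [e] at hs ⊢
    nlinarith

/-- The opposite side meets `W` by `exists_circleFun_pos`. The disc itself does not, since `a` is
either disjoint from or inside each `e_j`. -/
theorem IsDescartes.interiorOf_circle (hW : IsDescartes W) {a : Fin 4 → ℤ} (ha : a ∈ roots) :
    interiorOf W (circle (combination W a)) = disc (combination W a) := by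
  refine Set.Subset.antisymm (Set.sUnion_subset ?_) (Set.subset_sUnion_of_mem ?_)
  · rintro _ ⟨⟨u, hu, hcu, rfl⟩, hdisj⟩
    rcases eq_or_eq_neg_of_circle_subset hu (hW.isCircleVector_combination ha.1) hcu.subset
      with h | h
    · rw [h]
    · exfalso
      obtain ⟨i, p, hp, hpos⟩ := hW.exists_circleFun_pos ha
      refine Set.disjoint_left.1 (hdisj i) (?_ : p ∈ disc u) hp
      have hu' : u = -combination W a := by rw [h, neg_neg]
      change circleFun u p < 0
      rw [hu', circleFun_eq_form, form_neg_left]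
      rw [circleFun_eq_form] at hpos
      linarith
  · refine ⟨⟨_, hW.isCircleVector_combination ha.1, rfl, rfl⟩, fun j => ?_⟩
    rw [Set.disjoint_left]
    intro p hp hpj
    change circleFun _ p < 0 at hp
    change circleFun (W j) p = 0 at hpj
    rw [← combination_single W j] at hpj
    rcases gram_le_neg_one_or ha.1 (single_mem_roots j).1 with h | h
    · have h1 := hW.circleFun_nonneg (isFuture_add_of_gram ha (single_mem_roots j) h) p
      rw [circleFun_combination_add] at h1
      linarith
    · have h1 := hW.circleFun_le (isFuture_sub_single ha h) p
      linarith

end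

section

variable {W : Matrix (Fin 4) (Fin 4) ℝ}

/-- The circle with integer coordinates `a` with respect to the rows of `W`. -/
def rootCircle (W : Matrix (Fin 4) (Fin 4) ℝ) (a : Fin 4 → ℤ) : Set Sphere :=
  circle (combination W a)

theorem rootCircle_neg (W : Matrix (Fin 4) (Fin 4) ℝ) (a : Fin 4 → ℤ) :
    rootCircle W (-a) = rootCircle W a := by
  rw [rootCircle, combination_neg, circle_neg, rootCircle]

theorem IsDescartes.injOn_rootCircle (hW : IsDescartes W) : Set.InjOn (rootCircle W) roots :=
  fun _ ha _ hb h => hW.eq_of_circle_subset ha hb h.symm.subset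

theorem superPacking_eq (W : Matrix (Fin 4) (Fin 4) ℝ) :
    superPacking W = rootCircle W '' roots := by
  ext C
  constructor
  · rintro ⟨U, hU, i, rfl⟩
    rw [act_apply]
    change rootCircle W _ ∈ _
    rcases mem_roots_or_neg_mem (a := Pi.single i 1 ᵥ* U.1)
      (by rw [(isOrthochronous_of_mem hU).gram_eq]; exact (single_mem_roots i).1) with h | h
    · exact ⟨_, h, rfl⟩
    · exact ⟨_, h, rootCircle_neg W _⟩
  · rintro ⟨a, ha, rfl⟩
    obtain ⟨U, hU, i, hi⟩ := exists_single_vecMul_eq_neg ha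
    refine ⟨U, hU, i, ?_⟩
    rw [act_apply, hi, ← rootCircle_neg]
    rfl

/-- In the other two cases of the trichotomy the function of `a` is nonnegative on the circle of
`b`; inclusion makes it zero there, and the roots coincide. -/
theorem IsDescartes.includes_iff (hW : IsDescartes W) {a b : Fin 4 → ℤ} (ha : a ∈ roots)
    (hb : b ∈ roots) :
    Includes W (rootCircle W a) (rootCircle W b) ↔ IsFuture (b - a) := by
  rw [Includes, rootCircle, rootCircle, hW.interiorOf_circle ha]
  constructor
  · intro h
    have hle : ∀ p ∈ circle (combination W b), circleFun (combination W a) p ≤ 0 :=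
      fun p hp => (h hp).elim (fun h => h.le) fun h => (show circleFun _ p < 0 from h).le
    have heq : (∀ p ∈ circle (combination W b), 0 ≤ circleFun (combination W a) p) →
        IsFuture (b - a) := fun hge => by
      have := hW.eq_of_circle_subset ha hb fun p hp => le_antisymm (hle p hp) (hge p hp)
      rw [this, sub_self]
      exact isFuture_zero
    rcases isFuture_trichotomy ha hb with h' | h' | h'
    · exact h'
    · refine heq fun p hp => ?_
      change circleFun _ p = 0 at hp
      rw [← hp]
      exact hW.circleFun_le h' p
    · refine heq fun p hp => ?_
      change circleFun _ p = 0 at hp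
      have := hW.circleFun_nonneg h' p
      rwa [circleFun_combination_add, hp, add_zero] at this
  · intro h p hp
    change circleFun _ p = 0 at hp
    have h1 := hW.circleFun_le h p
    rw [hp] at h1
    exact h1.eq_or_lt

theorem IsDescartes.nestingDepth_rootCircle (hW : IsDescartes W) {b : Fin 4 → ℤ}
    (hb : b ∈ roots) : nestingDepth W (rootCircle W b) = (ancestors b).encard := by
  rw [nestingDepth, ← (hW.injOn_rootCircle.mono fun y hy => hy.1 :
    Set.InjOn (rootCircle W) (ancestors b)).encard_image]
  congr 1
  ext C
  rw [Set.mem_ofPred_eq, superPacking_eq]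
  constructor
  · rintro ⟨⟨y, hy, rfl⟩, hne, hinc⟩
    exact ⟨y, ⟨hy, fun h => hne (h ▸ rfl), (hW.includes_iff hy hb).1 hinc⟩, rfl⟩
  · rintro ⟨y, ⟨hy, hne, hf⟩, rfl⟩
    exact ⟨⟨y, hy, rfl⟩, fun h => hne (hW.injOn_rootCircle hy hb h), (hW.includes_iff hy hb).2 hf⟩

theorem IsDescartes.circlesAtDepth_eq (hW : IsDescartes W) (k : ℕ) :
    circlesAtDepth W k = rootCircle W '' rootsAtDepth k := by
  ext C
  rw [circlesAtDepth, Set.mem_ofPred_eq, superPacking_eq]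
  constructor
  · rintro ⟨⟨b, hb, rfl⟩, h⟩
    exact ⟨b, ⟨hb, hW.nestingDepth_rootCircle hb ▸ h⟩, rfl⟩
  · rintro ⟨b, hb, rfl⟩
    exact ⟨⟨b, hb.1, rfl⟩, hW.nestingDepth_rootCircle hb.1 ▸ hb.2⟩

theorem IsDescartes.pairwiseDisjoint_circlesAtDepth (hW : IsDescartes W) (k : ℕ) :
    (circlesAtDepth W k).PairwiseDisjoint (interiorOf W) := by
  rw [hW.circlesAtDepth_eq]
  rintro _ ⟨a, ha, rfl⟩ _ ⟨b, hb, rfl⟩ hne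
  change Disjoint (interiorOf W (circle _)) (interiorOf W (circle _))
  rw [hW.interiorOf_circle ha.1, hW.interiorOf_circle hb.1]
  exact hW.disjoint_disc (isFuture_add_of_mem_rootsAtDepth ha hb fun h => hne (h ▸ rfl))

/-! ### The Apollonian packing bounded by a root -/

/-- The circle of the root `a` together with the circles of its children. -/
def packingInside (W : Matrix (Fin 4) (Fin 4) ℝ) (a : Fin 4 → ℤ) : Set (Set Sphere) :=
  insert (rootCircle W a) (rootCircle W '' {b | IsChild a b})

theorem IsDescartes.isApollonianPacking_packingInside (hW : IsDescartes W) {a : Fin 4 → ℤ}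
    (ha : a ∈ roots) : IsApollonianPacking (packingInside W a) := by
  obtain ⟨U, hU, i, hi⟩ := exists_single_vecMul_eq_neg ha
  have ho := isOrthochronous_of_mem hU
  refine ⟨act U W, hW.act_of_mem hU, ?_⟩
  have horbit : ∀ C, C ∈ orbitCircles apollonianGroup (act U W) ↔
      ∃ x, IsOutermost x ∧ rootCircle W (x ᵥ* U.1) = C := by
    intro C
    simp only [isOutermost_iff]
    constructor
    · rintro ⟨V, hV, j, rfl⟩
      refine ⟨_, ⟨V, hV, j, rfl⟩, ?_⟩
      rw [← act_mul, act_apply, vecMul_mul, rootCircle]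
    · rintro ⟨_, ⟨V, hV, j, rfl⟩, rfl⟩
      refine ⟨V, hV, j, ?_⟩
      rw [← act_mul, act_apply, vecMul_mul, rootCircle]
  ext C
  rw [horbit]
  constructor
  · rintro (rfl | ⟨b, hb, rfl⟩)
    · exact ⟨_, isOutermost_single i, by rw [hi, rootCircle_neg]⟩
    · obtain ⟨x, hx, -, rfl⟩ := IsChild.exists_isOutermost ho hi hb
      exact ⟨x, hx, rfl⟩
  · rintro ⟨x, hx, rfl⟩
    by_cases hne : x = Pi.single i 1
    · left
      rw [hne, hi, rootCircle_neg]
    · exact .inr ⟨_, hx.isChild ho ha hi hne, rfl⟩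

theorem IsDescartes.includes_of_mem_packingInside (hW : IsDescartes W) {a : Fin 4 → ℤ}
    (ha : a ∈ roots) {C : Set Sphere} (hC : C ∈ packingInside W a) :
    Includes W (rootCircle W a) C := by
  rcases hC with rfl | ⟨b, hb, rfl⟩
  · exact Set.subset_union_left
  · exact (hW.includes_iff ha hb.right_mem).2 hb.isFuture

theorem IsDescartes.packingInside_diff (hW : IsDescartes W) {a : Fin 4 → ℤ} :
    packingInside W a \ {rootCircle W a} = rootCircle W '' {b | IsChild a b} := by
  refine Set.insert_sdiff_self_of_notMem ?_
  rintro ⟨b, hb, h⟩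
  exact hb.ne (hW.injOn_rootCircle hb.right_mem hb.left_mem h).symm

/-- The bounding circle is determined by the packing, as two such circles would include each other.
-/
theorem IsDescartes.injOn_packingInside (hW : IsDescartes W) :
    Set.InjOn (packingInside W) roots := by
  intro a ha b hb h
  have h1 := hW.includes_of_mem_packingInside ha (h ▸ Set.mem_insert _ _ : rootCircle W b ∈ _)
  have h2 := hW.includes_of_mem_packingInside hb (h ▸ Set.mem_insert _ _ : rootCircle W a ∈ _)
  exact ((hW.includes_iff ha hb).1 h1).antisymm ((hW.includes_iff hb ha).1 h2)

end

end SuperPacking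

/-! ### Assembly -/

theorem theorem3p2 (W : Matrix (Fin 4) (Fin 4) ℝ) (hW : SuperPacking.IsDescartes W)
    (k : ℕ) (hk : 1 ≤ k) :
    (SuperPacking.circlesAtDepth W k).PairwiseDisjoint (SuperPacking.interiorOf W) ∧
    ∃ (F : Set (Set (Set SuperPacking.Sphere)))
      (missing : Set (Set SuperPacking.Sphere) → Set SuperPacking.Sphere),
      F.Infinite ∧
      (∀ P ∈ F, SuperPacking.IsApollonianPacking P ∧
        missing P ∈ P ∧
        missing P ∈ SuperPacking.circlesAtDepth W (k - 1) ∧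
        ∀ C ∈ P, SuperPacking.Includes W (missing P) C) ∧
      F.PairwiseDisjoint (fun P => P \ {missing P}) ∧
      SuperPacking.circlesAtDepth W k = ⋃ P ∈ F, P \ {missing P} := by
  open SuperPacking in
  refine ⟨hW.pairwiseDisjoint_circlesAtDepth k, ?_⟩
  obtain ⟨k, rfl⟩ := Nat.exists_eq_add_of_le' hk
  rw [Nat.add_sub_cancel]
  have hinj : Set.InjOn (packingInside W) (rootsAtDepth k) :=
    hW.injOn_packingInside.mono fun a ha => ha.1
  have hmiss : ∀ a ∈ rootsAtDepth k, rootCircle W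
      (Function.invFunOn (packingInside W) (rootsAtDepth k) (packingInside W a))
        = rootCircle W a := fun a ha => by rw [hinj.leftInvOn_invFunOn ha]
  -- One packing for each root one level up; injectivity of `packingInside W` lets the bounding
  -- circle be a function of the packing.
  refine ⟨packingInside W '' rootsAtDepth k,
    fun P => rootCircle W (Function.invFunOn (packingInside W) (rootsAtDepth k) P),
    (infinite_rootsAtDepth k).image hinj, ?_, ?_, ?_⟩
  · rintro _ ⟨a, ha, rfl⟩
    dsimp only
    rw [hmiss a ha, hW.circlesAtDepth_eq]
    exact ⟨hW.isApollonianPacking_packingInside ha.1, Set.mem_insert _ _,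
      Set.mem_image_of_mem _ ha, fun C hC => hW.includes_of_mem_packingInside ha.1 hC⟩
  · rintro _ ⟨a, ha, rfl⟩ _ ⟨b, hb, rfl⟩ hne
    dsimp only [Function.onFun]
    rw [hmiss a ha, hmiss b hb, hW.packingInside_diff, hW.packingInside_diff,
      Set.disjoint_left]
    rintro _ ⟨c, hc, rfl⟩ ⟨d, hd, hdc⟩
    have h := hW.injOn_rootCircle hd.right_mem hc.right_mem hdc
    subst h
    exact hne (by rw [hc.unique hd])
  · rw [hW.circlesAtDepth_eq, Set.biUnion_image]
    ext C
    simp only [Set.mem_iUnion, exists_prop]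
    constructor
    · rintro ⟨b, hb, rfl⟩
      obtain ⟨a, ha, hab⟩ := exists_isChild_of_mem_rootsAtDepth hb
      refine ⟨a, ha, ?_⟩
      rw [hmiss a ha, hW.packingInside_diff]
      exact ⟨b, hab, rfl⟩
    · rintro ⟨a, ha, hC⟩
      rw [hmiss a ha, hW.packingInside_diff] at hC
      obtain ⟨b, hab, rfl⟩ := hC
      exact ⟨b, hab.mem_rootsAtDepth ha, rfl⟩
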